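/- Let $\mathcal H_{in}$ be a finite-dimensional Hilbert space, let $\mathcal H$ be a Hilbert space of finite dimension $d\ge 1$, let $M$ be the number of users, and let $\mathcal K=\mathcal H\otimes\mathcal H$. An SDI-channel (channel for symmetric distribution of information) is a completely positive trace-preserving map $\mathcal E$ from operators on $\mathcal H_{in}$ to operators on $\mathcal H^{\otimes M}$ such that for every input state $\rho$ the output state $\mathcal E(\rho)$ is invariant under all permutations of the $M$ tensor factors. Let $d\Psi$ be the normalized Haar measure over the pure states $|\Psi\rangle\in\mathcal K$, let $\rho(\Psi)=\mathrm{Tr}_{2}\,|\Psi\rangle\langle\Psi|$ be the reduced state on the first factor $\mathcal H$, let $D_n^+$ be the dimension of the totally symmetric subspace of $\mathcal K^{\otimes n}$, and put $S_{M,k}=1-\sqrt{D_{M-k}^+/D_M^+}$ for $0\le k\le M$. (1) For every SDI-channel $\mathcal E$ there is a quantum measurement with operator density $P_\Psi$ (that is, $P_\Psi\ge 0$ depends only on the pure state $|\Psi\rangle\langle\Psi|$, is integrable, and $\int d\Psi\,P_\Psi=1_{in}$) such that the measure-and-prepare channel $$\widetilde{\mathcal E}(\rho)=\int d\Psi\;\mathrm{Tr}[P_\Psi\rho]\;\rho(\Psi)^{\otimes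 M}$$ satisfies the following for every $k$, every group of $k$ of the $M$ users and every input state $\rho$: the reduced states $\rho_{out}^{(k)}$ and $\tilde\rho_{out}^{(k)}$ of $\mathcal E(\rho)$ and $\widetilde{\mathcal E}(\rho)$ for this group satisfy $$\|\rho_{out}^{(k)}-\tilde\rho_{out}^{(k)}\|_1\le 4S_{M,k}\qquad\text{and}\qquad \|\rho_{out}^{(k)}-\tilde\rho_{out}^{(k)}\|_1\le\frac{2(d^2-1)k}{M},$$ where $\|A\|_1=\mathrm{Tr}|A|$ (for $M=k=0$ the last right-hand side is read as $0$). (2) The bound $4S_{M,k}$ is asymptotically $2(d^2-1)k/M$ for $M\gg kd^2$: for every $\varepsilon>0$ there is a constant $C$, independent of $d$, $M$ and $k$, such that for all $d\ge1$ and $k\le M$ with $M\ge C\,k\,d^2$, $$\left|4S_{M,k}-\frac{2(d^2-1)k}{M}\right|\le\varepsilon\,\frac{2(d^2-1)k}{M}.$$ -/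

import Mathlib

open MeasureTheory
open scoped MatrixOrder Matrix.Norms.L2Operator CStarAlgebra ComplexOrder

noncomputable section

namespace SDI

/-- Operators on `ℂ^κ`, written as matrices in the standard orthonormal basis. -/
abbrev Op (κ : Type) : Type := Matrix κ κ ℂ

/-- Operators on `H^{⊗M}` with `H = ℂ^d`: the basis vectors `e_{f 0} ⊗ ⋯ ⊗ e_{f (M-1)}` are
indexed by the functions `f : Fin M → Fin d`. -/
abbrev OpPow (d M : ℕ) : Type := Op (Fin M → Fin d)

/-- The density matrices. -/
structure IsState {κ : Type} [Fintype κ] (ρ : Op κ) : Prop where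
  posSemidef : ρ.PosSemidef
  trace_eq_one : ρ.trace = 1

/-- Invariance under permutations of the `M` tensor factors, `U_π X U_π† = X` for all `π`, where
`U_π` is the unitary permuting the factors; in matrix entries `X (f ∘ π) (g ∘ π) = X f g`. -/
def IsPermInvariant {d M : ℕ} (X : OpPow d M) : Prop :=
  ∀ π : Equiv.Perm (Fin M), X.submatrix (fun f => f ∘ π) (fun f => f ∘ π) = X

/-- A completely positive map `E` from operators on `ℂ^m` to operators on `(ℂ^d)^{⊗M}` is a channel
for symmetric distribution of information if it preserves the trace and all its output states are
permutation invariant. -/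
structure IsSDIChannel {d m M : ℕ} (E : Op (Fin m) →CP OpPow d M) : Prop where
  trace_preserving : ∀ X : Op (Fin m), (E X).trace = X.trace
  perm_invariant : ∀ ρ : Op (Fin m), IsState ρ → IsPermInvariant (E ρ)

/-- Partial trace over the second tensor factor. -/
def traceSnd {α β : Type} [Fintype β] (X : Op (α × β)) : Op α :=
  Matrix.of fun a a' => ∑ b, X (a, b) (a', b)

/-- The reduced operator of the users in `S`: the partial trace over all users outside `S`. -/
def reduced {d M : ℕ} (S : Finset (Fin M)) (X : OpPow d M) : Op ({i // i ∈ S} → Fin d) :=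
  traceSnd (X.submatrix
    (Equiv.piEquivPiSubtypeProd (fun i => i ∈ S) (fun _ => Fin d)).symm
    (Equiv.piEquivPiSubtypeProd (fun i => i ∈ S) (fun _ => Fin d)).symm)

/-- The trace norm `Tr √(A† A)`, that is, the sum of the singular values of `A`. -/
def traceNorm {κ : Type} [Fintype κ] [DecidableEq κ] (A : Op κ) : ℝ :=
  ∑ i, √((Matrix.isHermitian_conjTranspose_mul_self A).eigenvalues i)

/-- The tensor power `σ^{⊗M}`. -/
def tensorPow {d : ℕ} (M : ℕ) (σ : Op (Fin d)) : OpPow d M :=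
  Matrix.of fun f g => ∏ i, σ (f i) (g i)

/-- `K = H ⊗ H` with `H = ℂ^d`, with its Hilbert space norm. -/
abbrev K (d : ℕ) : Type := EuclideanSpace ℂ (Fin d × Fin d)

/-- The unit vectors of `K = H ⊗ H`. -/
abbrev UnitVec (d : ℕ) : Type := Metric.sphere (0 : K d) 1

/-- The projection `|Ψ⟩⟨Ψ|`. -/
def proj {d : ℕ} (Ψ : UnitVec d) : Op (Fin d × Fin d) :=
  Matrix.of fun x y => (Ψ : K d) x * star ((Ψ : K d) y)

/-- The reduced state `ρ(Ψ)` on `H` of the pure state `|Ψ⟩⟨Ψ|` on `H ⊗ H`. -/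
def rhoOf {d : ℕ} (Ψ : UnitVec d) : Op (Fin d) := traceSnd (proj Ψ)

/-- The normalized rotation-invariant measure on the unit sphere of `K = H ⊗ H`. -/
def haar (d : ℕ) : Measure (UnitVec d) :=
  ((volume : Measure (K d)).toSphere Set.univ)⁻¹ • (volume : Measure (K d)).toSphere

/-- `P_Ψ dΨ` is a quantum measurement on `ℂ^m` whose outcomes are the pure states `|Ψ⟩⟨Ψ|` on `K`:
`P` is a positive operator density with respect to the normalized measure, it depends on the unit
vector `Ψ` only through `|Ψ⟩⟨Ψ|`, and `∫ dΨ P_Ψ = 1`. -/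
structure IsMeasurement {d m : ℕ} (P : UnitVec d → Op (Fin m)) : Prop where
  posSemidef : ∀ Ψ, (P Ψ).PosSemidef
  congr_proj : ∀ Ψ Ψ', proj Ψ = proj Ψ' → P Ψ = P Ψ'
  integrable : ∀ i j, Integrable (fun Ψ => P Ψ i j) (haar d)
  integral_eq_one : ∀ i j, ∫ Ψ, P Ψ i j ∂(haar d) = (1 : Op (Fin m)) i j

/-- The measure-and-prepare map `ρ ↦ ∫ dΨ Tr[P_Ψ ρ] ρ(Ψ)^{⊗M}`, the integral being taken entry by
entry. -/
def measurePrepare {d m : ℕ} (M : ℕ) (P : UnitVec d → Op (Fin m)) (ρ : Op (Fin m)) : OpPow d M :=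
  Matrix.of fun f g => ∫ Ψ, (P Ψ * ρ).trace * tensorPow M (rhoOf Ψ) f g ∂(haar d)

/-- The totally symmetric subspace of `K^{⊗n}`, `K = H ⊗ H`; vectors of `K^{⊗n}` are given by their
components in the product basis. -/
def symSubspace (d n : ℕ) : Submodule ℂ ((Fin n → Fin d × Fin d) → ℂ) where
  carrier := {v | ∀ (π : Equiv.Perm (Fin n)) (f : Fin n → Fin d × Fin d), v (f ∘ π) = v f}
  add_mem' := fun ha hb π f => by simp only [Pi.add_apply, ha π f, hb π f]
  zero_mem' := fun _ _ => rfl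
  smul_mem' := fun c _ ha π f => by simp only [Pi.smul_apply, ha π f]

/-- `D_n^+`, the dimension of the totally symmetric subspace of `K^{⊗n}`. -/
def symDim (d n : ℕ) : ℕ := Module.finrank ℂ (symSubspace d n)

/-- `S_{M,k} = 1 - √(D_{M-k}^+ / D_M^+)` (used for `k ≤ M`). -/
def bigS (d M k : ℕ) : ℝ := 1 - √((symDim d (M - k) : ℝ) / (symDim d M : ℝ))

end SDI

end

noncomputable section

namespace SDI

/-! The argument passes to a symmetric purification and compares it with its coherent-state
measurement. Complete positivity makes the Choi matrix positive, and its positive square root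
inherits the permutation invariance of the outputs. The entries of the root, read as tensors over K
= H ⊗ H, are totally symmetric vectors (`IsSDIChannel.exists_purification`). Hence every output E(ρ)
is, up to tracing out the second factor of each K, a sum of projections onto symmetric vectors u_j
of K^{⊗M}.

On the symmetric subspace D_M ∫ |Ψ^{⊗M}⟩⟨Ψ^{⊗M}| dΨ is the identity (`integral_amp_mul_star_amp`).
Measuring the purification with this resolution and pulling back to the input gives P_Ψ, and the
prepared state becomes D_M ∫ Σ_j |⟨Ψ^{⊗M}|u_j⟩|² ρ(Ψ)^{⊗M} dΨ.

The heart is `contract_le_integral`. For a test vector y on k factors let w be the partial inner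
product of u with y, and put a = ⟨Ψ^{⊗(M-k)}|w⟩ and b = ⟨Ψ^{⊗M}|u⟩ · conj⟨Ψ^{⊗k}|y⟩. The resolutions
of the identity in degrees M-k and M give D_{M-k} ∫|a|² = D_M ∫ b·conj(a) = ‖w‖². Expanding ∫
|√D_{M-k} a - √D_M b|² ≥ 0 then shows that the reduced prepared state dominates (1 - 2S) times the
reduced output, as operators (`posSemidef_reduced_sub`).

Consequently the difference of the two reduced states is a difference of two positive operators,
each of trace 2S, so its trace norm is at most 4S. The explicit bound and the asymptotics follow
from D_{M-k}/D_M = ∏_j (1 - k/(M+j)), j = 1, …, d²-1, by Bernoulli's inequality from one side and an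
exponential estimate from the other. -/

/-! ### Moments of the uniform measure on the unit sphere, from Gaussian integrals. -/

/-- The component of `Ψ^{⊗ι}` at the product basis vector `f`. -/
def pw {κ ι : Type} [Fintype ι] (x : κ → ℂ) (f : ι → κ) : ℂ := ∏ i, x (f i)

theorem pw_eq_prod_pow {κ ι : Type} [Fintype κ] [DecidableEq κ] [Fintype ι]
    (x : κ → ℂ) (f : ι → κ) :
    pw x f = ∏ k, x k ^ Fintype.card {i // f i = k} := by
  rw [pw, ← Finset.prod_fiberwise (s := Finset.univ) (g := f)]
  refine Finset.prod_congr rfl fun k _ => ?_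
  rw [Finset.prod_congr rfl (g := fun _ => x k), Finset.prod_const, Fintype.card_subtype]
  intro i hi
  rw [(Finset.mem_filter.1 hi).2]

theorem pw_smul {κ ι : Type} [Fintype ι] (r : ℂ) (x : κ → ℂ) (f : ι → κ) :
    pw (fun k => r * x k) f = r ^ Fintype.card ι * pw x f := by
  simp [pw, Finset.prod_mul_distrib]

/-- If one solution `π₀` exists, left translation by its inverse identifies the solutions with the
stabilizer of `f`, a product of symmetric groups of the fibres. A solution exists exactly when the
fibres of `f` and `g` have equal sizes. -/
theorem card_perm_comp_eq {κ ι : Type} [Fintype κ] [DecidableEq κ] [Fintype ι] [DecidableEq ι]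
    (f g : ι → κ) :
    Fintype.card {π : Equiv.Perm ι // g ∘ π = f} =
      if ∀ k, Fintype.card {i // f i = k} = Fintype.card {i // g i = k} then
        ∏ k, (Fintype.card {i // f i = k}).factorial else 0 := by
  split_ifs with h
  · let e := fun k => Fintype.equivOfCardEq (h k)
    let π₀ : Equiv.Perm ι := Equiv.ofFiberEquiv e
    have hπ₀ : g ∘ π₀ = f := funext fun i => Equiv.ofFiberEquiv_map e i
    rw [← DomMulAct.stabilizer_card]
    refine Fintype.card_congr (Equiv.subtypeEquiv (Equiv.mulLeft π₀⁻¹) fun π => ?_)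
    have hinv : ∀ j, f (π₀⁻¹ j) = g j := fun j =>
      (congrFun hπ₀ (π₀⁻¹ j)).symm.trans (congrArg g (π₀.apply_symm_apply j))
    exact funext_iff.trans ((forall_congr' fun i => by
      rw [Function.comp_apply, Function.comp_apply, Equiv.coe_mulLeft, Equiv.Perm.mul_apply,
        hinv]).trans funext_iff.symm)
  · rw [Fintype.card_eq_zero_iff]
    refine ⟨fun π => h fun k => Fintype.card_congr (Equiv.subtypeEquiv π.1 fun i => ?_)⟩
    exact (congrFun π.2 i).symm ▸ Iff.rfl

theorem integral_complex_moment (a b : ℕ) :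
    ∫ z : ℂ, z ^ a * star (z ^ b) * (Real.exp (-‖z‖ ^ 2) : ℂ) =
      if a = b then (Real.pi * a.factorial : ℂ) else 0 := by
  split_ifs with h
  · subst h
    have h1 := Complex.integral_rpow_mul_exp_neg_rpow (p := 2) (q := 2 * a) (by norm_num)
      (by have : (0 : ℝ) ≤ a := a.cast_nonneg
          linarith)
    have h2 : ∀ z : ℂ, z ^ a * star (z ^ a) * (Real.exp (-‖z‖ ^ 2) : ℂ) =
        ((‖z‖ ^ (2 * a : ℝ) * Real.exp (-‖z‖ ^ (2 : ℝ)) : ℝ) : ℂ) := by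
      intro z
      have : (‖z‖ ^ (2 * a : ℝ) : ℝ) = (‖z‖ ^ a) ^ 2 := by
        rw [← pow_mul, mul_comm a 2]
        exact_mod_cast Real.rpow_natCast ‖z‖ (2 * a)
      rw [this]
      have h3 := Complex.mul_conj' (z ^ a)
      simp only [Complex.star_def]
      rw [h3, norm_pow]
      norm_num
    simp_rw [h2]
    rw [integral_complex_ofReal, h1, show (2 * (a : ℝ) + 2) / 2 = a + 1 by ring, Real.Gamma_nat_eq_factorial]
    push_cast
    norm_num
  -- The phase π/(a - b) multiplies the integrand by e^{iπ} = -1, while the rotation preserves the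
  -- measure, so the integral equals its own negative.
  · obtain ⟨c, hc⟩ : ∃ c : Circle, (c : ℂ) ^ a * star ((c : ℂ) ^ b) = -1 := by
      refine ⟨Circle.exp (Real.pi / ((a : ℝ) - b)), ?_⟩
      have hab : (a : ℂ) - b ≠ 0 := sub_ne_zero.2 (by exact_mod_cast h)
      rw [Circle.coe_exp, ← Complex.exp_nat_mul, ← Complex.exp_nat_mul, Complex.star_def,
        ← Complex.exp_conj, ← Complex.exp_add, ← Complex.exp_pi_mul_I]
      congr 1
      simp only [map_mul, Complex.conj_I, Complex.conj_ofReal, Complex.conj_natCast]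
      push_cast
      field_simp
      ring
    have h1 := (rotation c).measurePreserving.integral_comp
      (rotation c).toHomeomorph.measurableEmbedding
      (fun z : ℂ => z ^ a * star (z ^ b) * (Real.exp (-‖z‖ ^ 2) : ℂ))
    have h2 : ∀ z : ℂ, (rotation c z) ^ a * star ((rotation c z) ^ b) *
        (Real.exp (-‖rotation c z‖ ^ 2) : ℂ) =
        - (z ^ a * star (z ^ b) * (Real.exp (-‖z‖ ^ 2) : ℂ)) := by
      intro z
      rw [LinearIsometryEquiv.norm_map, rotation_apply, mul_pow, mul_pow, star_mul']
      linear_combination (z ^ a * star (z ^ b) * (Real.exp (-‖z‖ ^ 2) : ℂ)) * hc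
    simp_rw [h2] at h1
    rw [integral_neg] at h1
    exact self_eq_neg.1 h1.symm

/-- The Gaussian moments of `ℂ^κ`. -/
theorem integral_pi_moment {κ ι : Type} [Fintype κ] [DecidableEq κ] [Fintype ι] [DecidableEq ι]
    (f g : ι → κ) :
    ∫ x : κ → ℂ, pw x f * star (pw x g) * (Real.exp (-∑ k, ‖x k‖ ^ 2) : ℂ) =
      Real.pi ^ Fintype.card κ * Fintype.card {π : Equiv.Perm ι // g ∘ π = f} := by
  have h1 : ∀ x : κ → ℂ, pw x f * star (pw x g) * (Real.exp (-∑ k, ‖x k‖ ^ 2) : ℂ) =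
      ∏ k, (x k ^ Fintype.card {i // f i = k} * star (x k ^ Fintype.card {i // g i = k}) *
        (Real.exp (-‖x k‖ ^ 2) : ℂ)) := by
    intro x
    rw [pw_eq_prod_pow, pw_eq_prod_pow, Finset.prod_mul_distrib, Finset.prod_mul_distrib,
      ← Finset.sum_neg_distrib, Real.exp_sum]
    simp
  simp_rw [h1]
  rw [volume_pi, integral_fintype_prod_eq_prod (f := fun k (z : ℂ) =>
    z ^ Fintype.card {i // f i = k} * star (z ^ Fintype.card {i // g i = k}) *
        (Real.exp (-‖z‖ ^ 2) : ℂ))]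
  simp_rw [integral_complex_moment, card_perm_comp_eq]
  split_ifs with h
  · simp [h, Finset.prod_mul_distrib]
  · push Not at h
    obtain ⟨k, hk⟩ := h
    simp only [Nat.cast_zero, mul_zero]
    exact Finset.prod_eq_zero (Finset.mem_univ k) (if_neg hk)

/-- The constant is chosen before the index type `ι`: it absorbs the ratio of two Haar measures, and
its value is never needed because it cancels on normalizing. -/
theorem euclidean_moment (κ : Type) [Fintype κ] [DecidableEq κ] :
    ∃ c : ℂ, c ≠ 0 ∧ ∀ (ι : Type) [Fintype ι] [DecidableEq ι] (f g : ι → κ),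
      ∫ x : EuclideanSpace ℂ κ, pw x f * star (pw x g) * (Real.exp (-‖x‖ ^ 2) : ℂ) =
        c * Fintype.card {π : Equiv.Perm ι // g ∘ π = f} := by
  let e : (κ → ℂ) ≃L[ℝ] EuclideanSpace ℂ κ := (PiLp.continuousLinearEquiv 2 ℝ (fun _ : κ => ℂ)).symm
  have : (Measure.map e (volume : Measure (κ → ℂ))).IsAddHaarMeasure :=
    e.isAddHaarMeasure_map _
  set ν := Measure.map e (volume : Measure (κ → ℂ))
  have hc := Measure.isAddLeftInvariant_eq_smul (volume : Measure (EuclideanSpace ℂ κ)) ν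
  set c := Measure.addHaarScalarFactor (volume : Measure (EuclideanSpace ℂ κ)) ν
  have hc0 : c ≠ 0 := (Measure.addHaarScalarFactor_pos_of_isAddHaarMeasure _ _).ne'
  refine ⟨(c : ℝ) * Real.pi ^ Fintype.card κ, ?_, ?_⟩
  · refine mul_ne_zero ?_ (pow_ne_zero _ (by exact_mod_cast Real.pi_ne_zero))
    exact_mod_cast hc0
  · intro ι _ _ f g
    have hmap (F : EuclideanSpace ℂ κ → ℂ) : ∫ y, F y ∂ν = ∫ x, F (e x) :=
      e.toHomeomorph.measurableEmbedding.integral_map F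
    rw [hc, integral_smul_nnreal_measure, hmap,
      mul_assoc, ← integral_pi_moment, NNReal.smul_def, Complex.real_smul]
    congr 2
    funext x
    congr 3
    simp only [EuclideanSpace.norm_sq_eq]
    rfl

theorem integral_polar {E : Type*} [NormedAddCommGroup E] [NormedSpace ℝ E] [MeasurableSpace E]
    [BorelSpace E] [FiniteDimensional ℝ E] (μ : Measure E) [μ.IsAddHaarMeasure]
    [Nontrivial E] (G : E → ℂ) (A : Metric.sphere (0 : E) 1 → ℂ) (B : ℝ → ℂ)
    (h : ∀ (s : Metric.sphere (0 : E) 1) (r : ℝ), 0 < r → G (r • (s : E)) = A s * B r) :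
    ∫ x, G x ∂μ = (∫ s, A s ∂μ.toSphere) *
      ∫ r in Set.Ioi (0 : ℝ), (r : ℂ) ^ (Module.finrank ℝ E - 1) * B r := by
  have h1 : ∫ x, G x ∂μ = ∫ x : ({0}ᶜ : Set E), G x.1 ∂(μ.comap (↑)) := by
    rw [integral_subtype_comap (measurableSet_singleton _).compl fun x => G x,
      restrict_compl_singleton]
  have h2 : ∀ x : ({0}ᶜ : Set E), G x.1 =
      (fun y : Metric.sphere (0 : E) 1 × Set.Ioi (0 : ℝ) => A y.1 * B y.2)
        (homeomorphUnitSphereProd E x) := by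
    intro x
    refine Eq.trans ?_ (h _ _ (homeomorphUnitSphereProd E x).2.2)
    congr 1
    exact congrArg Subtype.val ((homeomorphUnitSphereProd E).symm_apply_apply x).symm
  rw [h1]
  simp_rw [h2]
  rw [μ.measurePreserving_homeomorphUnitSphereProd.integral_comp
    (Homeomorph.measurableEmbedding _)
    (fun y : Metric.sphere (0 : E) 1 × Set.Ioi (0 : ℝ) => A y.1 * B y.2),
    integral_prod_mul (f := A) (g := fun r : Set.Ioi (0 : ℝ) => B r)]
  congr 1
  simp only [Measure.volumeIoiPow, ENNReal.ofReal]
  rw [integral_withDensity_eq_integral_smul,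
    integral_subtype_comap measurableSet_Ioi
      fun a => Real.toNNReal (a ^ (Module.finrank ℝ E - 1)) • B a,
    setIntegral_congr_fun measurableSet_Ioi fun x hx => ?_]
  · rw [NNReal.smul_def, Real.coe_toNNReal _ (pow_nonneg hx.out.le _), Complex.real_smul]
    push_cast
    rfl
  · exact (measurable_subtype_coe.pow_const _).real_toNNReal

theorem radial_integral (p n : ℕ) :
    ∫ r in Set.Ioi (0 : ℝ), (r : ℂ) ^ (2 * (p + 1) - 1) *
      ((r : ℂ) ^ (2 * n) * (Real.exp (-r ^ 2) : ℂ)) = ((p + n).factorial : ℂ) / 2 := by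
  have h := integral_rpow_mul_exp_neg_rpow (p := 2) (q := (2 * (p + n) + 1 : ℕ)) (by norm_num)
    (lt_of_lt_of_le (by norm_num) (Nat.cast_nonneg _))
  have h2 : ∀ r ∈ Set.Ioi (0 : ℝ), (r : ℂ) ^ (2 * (p + 1) - 1) *
      ((r : ℂ) ^ (2 * n) * (Real.exp (-r ^ 2) : ℂ)) =
      ((r ^ ((2 * (p + n) + 1 : ℕ) : ℝ) * Real.exp (-r ^ (2 : ℝ)) : ℝ) : ℂ) := by
    intro r _
    rw [Real.rpow_natCast, show (2 : ℝ) = (2 : ℕ) by norm_num, Real.rpow_natCast]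
    push_cast
    rw [← mul_assoc, ← pow_add]
    congr 2
    omega
  rw [setIntegral_congr_fun measurableSet_Ioi h2, integral_complex_ofReal, h,
    show (((2 * (p + n) + 1 : ℕ) : ℝ) + 1) / 2 = (p + n : ℕ) + 1 by push_cast; ring,
    Real.Gamma_nat_eq_factorial]
  push_cast
  ring

/-- Moments of the unnormalized uniform measure on the unit sphere of `ℂ^κ`. -/
theorem sphere_moment (κ : Type) [Fintype κ] [DecidableEq κ] [Nonempty κ] :
    ∃ c : ℂ, c ≠ 0 ∧ ∀ (ι : Type) [Fintype ι] [DecidableEq ι] (f g : ι → κ),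
      ∫ x, pw (x : EuclideanSpace ℂ κ) f * star (pw (x : EuclideanSpace ℂ κ) g)
          ∂(volume : Measure (EuclideanSpace ℂ κ)).toSphere =
        c * Fintype.card {π : Equiv.Perm ι // g ∘ π = f} /
          ((Fintype.card κ - 1 + Fintype.card ι).factorial : ℂ) := by
  obtain ⟨c, hc, h⟩ := euclidean_moment κ
  refine ⟨2 * c, mul_ne_zero two_ne_zero hc, fun ι _ _ f g => ?_⟩
  -- The Gaussian moment factors in polar coordinates, since the monomial is homogeneous of degree
  -- 2·|ι| under positive real scaling; dividing by the radial factor leaves the spherical moment.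
  have h1 := integral_polar (volume : Measure (EuclideanSpace ℂ κ))
    (fun x => pw x f * star (pw x g) * (Real.exp (-‖x‖ ^ 2) : ℂ))
    (fun s => pw (s : EuclideanSpace ℂ κ) f * star (pw (s : EuclideanSpace ℂ κ) g))
    (fun r => (r : ℂ) ^ (2 * Fintype.card ι) * (Real.exp (-r ^ 2) : ℂ)) (by
      intro s r hr
      have hs : ‖(s : EuclideanSpace ℂ κ)‖ = 1 := by simp
      have hf : ∀ f : ι → κ, pw (r • (s : EuclideanSpace ℂ κ)) f =
          (r : ℂ) ^ Fintype.card ι * pw (s : EuclideanSpace ℂ κ) f := by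
        intro f
        rw [← pw_smul]
        rfl
      simp only
      rw [hf, hf, norm_smul, hs, star_mul', mul_one, Real.norm_of_nonneg hr.le, star_pow,
        Complex.star_def, Complex.conj_ofReal]
      ring)
  have hdim : Module.finrank ℝ (EuclideanSpace ℂ κ) = 2 * (Fintype.card κ - 1 + 1) := by
    rw [← Module.finrank_mul_finrank ℝ ℂ, Complex.finrank_real_complex, finrank_euclideanSpace,
      Nat.sub_add_cancel Fintype.card_pos]
  rw [h, hdim, radial_integral] at h1
  have h0 : ((Fintype.card κ - 1 + Fintype.card ι).factorial : ℂ) ≠ 0 := by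
    exact_mod_cast Nat.factorial_ne_zero _
  rw [eq_div_iff h0]
  linear_combination (-2) * h1

variable {d : ℕ}

theorem isProbabilityMeasure_haar (hd : 1 ≤ d) : IsProbabilityMeasure (haar d) := by
  have : NeZero d := ⟨by omega⟩
  refine ⟨?_⟩
  rw [haar, Measure.smul_apply, smul_eq_mul]
  refine ENNReal.inv_mul_cancel ?_ (measure_ne_top _ _)
  exact Measure.measure_univ_ne_zero.2 (Measure.toSphere_ne_zero _)

/-- `C(n + d² - 1, n)`, the dimension of the symmetric subspace of `K^{⊗n}`. -/
def symNum (d n : ℕ) : ℕ := (d * d - 1 + n).choose n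

theorem symNum_pos (d n : ℕ) : 0 < symNum d n := Nat.choose_pos (by omega)

/-- The moments of the uniform probability measure on the unit sphere of `K`. -/
theorem integral_haar_pw (hd : 1 ≤ d) {ι : Type} [Fintype ι] [DecidableEq ι]
    (f g : ι → Fin d × Fin d) :
    (symNum d (Fintype.card ι) : ℂ) * ∫ Ψ, pw (Ψ : K d) f * star (pw (Ψ : K d) g) ∂(haar d) =
      Fintype.card {π : Equiv.Perm ι // g ∘ π = f} / ((Fintype.card ι).factorial : ℂ) := by
  have : NeZero d := ⟨by omega⟩
  obtain ⟨c, hc, h⟩ := sphere_moment (Fin d × Fin d)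
  -- The moment of degree zero is the total mass of the sphere and fixes the normalization.
  have hnorm := h Empty (fun x => x.elim) (fun x => x.elim)
  have := isProbabilityMeasure_haar hd
  have hm := h ι f g
  set t := (volume : Measure (K d)).toSphere Set.univ
  have ht : ((t.toReal : ℝ) : ℂ) = c / ((d * d - 1).factorial : ℂ) := by
    have h1 : Fintype.card {π : Equiv.Perm Empty //
        (fun x : Empty => (x.elim : Fin d × Fin d)) ∘ π = fun x => x.elim} = 1 :=
      Fintype.card_eq_one_iff.2 ⟨⟨1, funext fun x => x.elim⟩,
        fun π => Subtype.ext (Equiv.ext fun x => x.elim)⟩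
    rw [h1] at hnorm
    simpa [pw, measureReal_def, t] using hnorm
  have hch : (symNum d (Fintype.card ι) : ℂ) * (Fintype.card ι).factorial *
      (d * d - 1).factorial = (d * d - 1 + Fintype.card ι).factorial := by
    have := Nat.add_choose_mul_factorial_mul_factorial (d * d - 1) (Fintype.card ι)
    rw [symNum]
    rw [← this]
    push_cast
    ring
  have h0 : ∀ n : ℕ, (n.factorial : ℂ) ≠ 0 := fun n => by exact_mod_cast Nat.factorial_ne_zero n
  rw [haar, integral_smul_measure, ENNReal.toReal_inv, Complex.real_smul, Complex.ofReal_inv, ht,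
    hm]
  simp only [Fintype.card_prod, Fintype.card_fin]
  rw [← hch]
  have h3 : (symNum d (Fintype.card ι) : ℂ) ≠ 0 := by exact_mod_cast (symNum_pos _ _).ne'
  have h4 := h0 (d * d - 1)
  have h5 := h0 (Fintype.card ι)
  field_simp

/-! ### Symmetric tensors and the dimension of the symmetric subspace. -/

/-- A tensor in `(ℂ^κ)^{⊗ι}` is totally symmetric. -/
def IsSymm {κ ι : Type} (u : (ι → κ) → ℂ) : Prop := ∀ (π : Equiv.Perm ι) (f : ι → κ), u (f ∘ π) = u f

theorem exists_perm_of_map_eq {κ ι : Type} [Fintype ι] [DecidableEq ι]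
    [Fintype κ] [DecidableEq κ] {f g : ι → κ}
    (h : Finset.univ.val.map f = Finset.univ.val.map g) : ∃ π : Equiv.Perm ι, g ∘ π = f := by
  have hk : ∀ k, Fintype.card {i // f i = k} = Fintype.card {i // g i = k} := by
    intro k
    have := congrArg (Multiset.count k) h
    rw [Multiset.count_map, Multiset.count_map] at this
    rw [Fintype.card_subtype, Fintype.card_subtype, Finset.card_def, Finset.card_def,
      Finset.filter_val, Finset.filter_val]
    simpa only [eq_comm] using this
  exact ⟨Equiv.ofFiberEquiv fun k => Fintype.equivOfCardEq (hk k),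
    funext fun i => Equiv.ofFiberEquiv_map _ i⟩

/-- The type of a basis vector of `K^{⊗n}`, a multiset of `n` basis vectors of `K`. -/
def symType {κ : Type} {n : ℕ} (f : Fin n → κ) : Sym κ n :=
  ⟨Finset.univ.val.map f, by simp⟩

theorem symType_surjective {κ : Type} {n : ℕ} :
    Function.Surjective (symType : (Fin n → κ) → Sym κ n) := by
  rintro ⟨s, hs⟩
  subst hs
  induction s using Quotient.inductionOn with
  | h l =>
    refine ⟨l.get, Subtype.ext ?_⟩
    show Multiset.map l.get (List.finRange l.length : Multiset (Fin l.length)) = (l : Multiset κ)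
    rw [Multiset.map_coe, List.map_get_finRange]

/-- A symmetric tensor has the same component at basis vectors of the same type, so it is an
arbitrary function on multisets of size n, and these are counted by stars and bars. -/
theorem symDim_eq (d n : ℕ) (hd : 1 ≤ d) : symDim d n = symNum d n := by
  let φ : (Sym (Fin d × Fin d) n → ℂ) →ₗ[ℂ] symSubspace d n :=
    { toFun := fun w => ⟨fun f => w (symType f), fun π f => by
        refine congrArg w (Subtype.ext ?_)
        exact (Multiset.map_map f π _).symm.trans
          (congrArg (Multiset.map f) (Multiset.map_univ_val_equiv π))⟩
      map_add' := fun _ _ => rfl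
      map_smul' := fun _ _ => rfl }
  have hinj : Function.Injective φ := by
    intro w w' h
    funext s
    obtain ⟨f, rfl⟩ := symType_surjective s
    exact congrFun (congrArg Subtype.val h) f
  have hsurj : Function.Surjective φ := by
    intro v
    refine ⟨fun s => v.1 (Function.surjInv symType_surjective s), Subtype.ext (funext fun f => ?_)⟩
    have h := Function.surjInv_eq symType_surjective (symType f)
    obtain ⟨π, hπ⟩ := exists_perm_of_map_eq (f := f)
      (g := Function.surjInv symType_surjective (symType f)) (congrArg Subtype.val h).symm
    exact ((v.2 π _).symm.trans (congrArg v.1 hπ) :)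
  rw [symDim, ← (LinearEquiv.ofBijective φ ⟨hinj, hsurj⟩).finrank_eq,
    Module.finrank_fintype_fun_eq_card, Sym.card_sym_eq_choose, symNum, Fintype.card_prod,
    Fintype.card_fin]
  congr 1
  have : 1 ≤ d * d := Nat.mul_pos hd hd
  omega

/-! ### Coherent states and the resolution of the identity. -/

/-- The amplitude `⟨Ψ^{⊗ι} | u⟩`. -/
def amp {κ ι : Type} [Fintype κ] [DecidableEq ι] [Fintype ι] (x : κ → ℂ) (u : (ι → κ) → ℂ) : ℂ :=
  ∑ f, star (pw x f) * u f

theorem continuous_pw {ι : Type} [Fintype ι] (f : ι → Fin d × Fin d) :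
    Continuous fun Ψ : UnitVec d => pw (Ψ : K d) f := by
  unfold pw
  fun_prop

theorem continuous_amp {ι : Type} [Fintype ι] [DecidableEq ι] (u : (ι → Fin d × Fin d) → ℂ) :
    Continuous fun Ψ : UnitVec d => amp (Ψ : K d) u :=
  continuous_finsetSum _ fun f _ => (continuous_pw f).star.mul continuous_const

theorem integrable_haar (hd : 1 ≤ d) {E : Type*} [NormedAddCommGroup E] {F : UnitVec d → E}
    (hF : Continuous F) : Integrable F (haar d) := by
  have := isProbabilityMeasure_haar hd
  exact hF.integrable_of_hasCompactSupport (HasCompactSupport.of_compactSpace F)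

theorem integral_sum_haar (hd : 1 ≤ d) {γ : Type} [Fintype γ] {F : γ → UnitVec d → ℂ}
    (hF : ∀ g, Continuous (F g)) :
    ∫ Ψ, ∑ g, F g Ψ ∂(haar d) = ∑ g, ∫ Ψ, F g Ψ ∂(haar d) :=
  integral_finsetSum _ fun g _ => integrable_haar hd (hF g)

/-- The reproducing property of the coherent states `Ψ^{⊗ι}` in the symmetric subspace. -/
theorem integral_pw_mul_amp (hd : 1 ≤ d) {ι : Type} [Fintype ι] [DecidableEq ι]
    {u : (ι → Fin d × Fin d) → ℂ} (hu : IsSymm u) (f : ι → Fin d × Fin d) :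
    (symNum d (Fintype.card ι) : ℂ) * ∫ Ψ, pw (Ψ : K d) f * amp (Ψ : K d) u ∂(haar d) = u f := by
  have h1 : ∀ Ψ : UnitVec d, pw (Ψ : K d) f * amp (Ψ : K d) u =
      ∑ g, pw (Ψ : K d) f * star (pw (Ψ : K d) g) * u g := by
    intro Ψ
    simp only [amp, Finset.mul_sum, mul_assoc]
  simp_rw [h1]
  rw [integral_sum_haar hd (F := fun g Ψ => pw (Ψ : K d) f * star (pw (Ψ : K d) g) * u g)
    fun g => ((continuous_pw f).mul (continuous_pw g).star).mul continuous_const, Finset.mul_sum]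
  simp_rw [integral_mul_const, ← mul_assoc, integral_haar_pw hd]
  -- Written as a sum over permutations, the normalized moments are the matrix entries of the
  -- symmetrizer, which fixes `u`.
  have h2 : ∀ g : ι → Fin d × Fin d, (Fintype.card {π : Equiv.Perm ι // g ∘ π = f} : ℂ) =
      ∑ π : Equiv.Perm ι, if g = f ∘ π.symm then 1 else 0 := by
    intro g
    rw [Fintype.card_subtype, Finset.card_filter]
    push_cast
    refine Finset.sum_congr rfl fun π _ => ?_
    congr 1
    rw [eq_iff_iff]
    exact (Equiv.eq_comp_symm π g f).symm
  simp_rw [h2, div_mul_eq_mul_div, Finset.sum_mul, ite_mul, one_mul, zero_mul]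
  rw [← Finset.sum_div, Finset.sum_comm]
  simp only [Finset.sum_ite_eq', Finset.mem_univ, if_true]
  simp only [hu _ f]
  rw [Finset.sum_const, Finset.card_univ, Fintype.card_perm, nsmul_eq_mul]
  have : ((Fintype.card ι).factorial : ℂ) ≠ 0 := by exact_mod_cast Nat.factorial_ne_zero _
  field_simp

/-- Resolution of the identity of the symmetric subspace. -/
theorem integral_amp_mul_star_amp (hd : 1 ≤ d) {ι : Type} [Fintype ι] [DecidableEq ι]
    {u v : (ι → Fin d × Fin d) → ℂ} (hu : IsSymm u) :
    (symNum d (Fintype.card ι) : ℂ) *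
      ∫ Ψ, amp (Ψ : K d) u * star (amp (Ψ : K d) v) ∂(haar d) = ∑ f, u f * star (v f) := by
  -- Only the reproducing property of `u` enters, so `v` may be any tensor; this freedom is used
  -- below for the non-symmetric product y ⊗ w.
  have h1 : ∀ Ψ : UnitVec d, amp (Ψ : K d) u * star (amp (Ψ : K d) v) =
      ∑ f, pw (Ψ : K d) f * amp (Ψ : K d) u * star (v f) := by
    intro Ψ
    conv_lhs => rw [amp.eq_1 (Ψ : K d) v, star_sum, Finset.mul_sum]
    refine Finset.sum_congr rfl fun f _ => ?_
    rw [star_mul', star_star]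
    ring
  simp_rw [h1]
  rw [integral_sum_haar hd (F := fun f Ψ => pw (Ψ : K d) f * amp (Ψ : K d) u * star (v f))
    fun f => ((continuous_pw f).mul (continuous_amp u)).mul continuous_const, Finset.mul_sum]
  simp_rw [integral_mul_const, ← mul_assoc, integral_pw_mul_amp hd hu]

/-! ### Splitting the tensor factors into two groups. -/

section Join

variable {κ ι : Type} (p : ι → Prop) [DecidablePred p]

/-- A basis vector of the tensor product from basis vectors for the factors in `p` and outside. -/
abbrev join : ({i // p i} → κ) × ({i // ¬p i} → κ) ≃ (ι → κ) :=
  (Equiv.piEquivPiSubtypeProd p fun _ => κ).symm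

theorem prod_join {β R : Type} [Fintype ι] [Fintype {i // p i}] [CommMonoid R] (φ : κ → β → R)
    (F : {i // p i} → κ) (e : {i // ¬p i} → κ) (F' : {i // p i} → β) (e' : {i // ¬p i} → β) :
    ∏ i, φ (join p (F, e) i) (join p (F', e') i) =
      (∏ i, φ (F i) (F' i)) * ∏ i, φ (e i) (e' i) := by
  obtain rfl : ‹Fintype {i // p i}› = Subtype.fintype p := Subsingleton.elim _ _
  rw [← Fintype.prod_subtype_mul_prod_subtype p]
  congr 1
  · refine Finset.prod_congr rfl fun i _ => ?_
    simp [i.2]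
  · refine Finset.prod_congr rfl fun i _ => ?_
    simp [i.2]

theorem pw_join [Fintype ι] [Fintype {i // p i}] (x : κ → ℂ) (F : {i // p i} → κ) (e : {i // ¬p i} → κ) :
    pw x (join p (F, e)) = pw x F * pw x e :=
  prod_join p (fun k (_ : κ) => x k) F e F e

theorem IsSymm.join_right {u : (ι → κ) → ℂ} (hu : IsSymm u) (F : {i // p i} → κ) :
    IsSymm fun e : {i // ¬p i} → κ => u (join p (F, e)) := by
  intro π e
  simp only
  -- A permutation of the factors outside `p` extends by the identity to one of all factors.
  rw [← hu (Equiv.Perm.subtypeCongr (Equiv.refl _) π) (join p (F, e))]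
  congr 1
  funext i
  by_cases hi : p i
  · simp [hi, Equiv.Perm.subtypeCongr.left_apply]
  · simp [hi, Equiv.Perm.subtypeCongr.right_apply, (π ⟨i, hi⟩).2]

/-- The partial inner product of `u` with a tensor `y` on the factors in `p`. -/
def contract [Fintype κ] [DecidableEq ι] [Fintype {i // p i}] (y : ({i // p i} → κ) → ℂ)
    (u : (ι → κ) → ℂ) (e : {i // ¬p i} → κ) : ℂ :=
  ∑ F, star (y F) * u (join p (F, e))

theorem IsSymm.contract [Fintype κ] [DecidableEq ι] [Fintype {i // p i}] {u : (ι → κ) → ℂ}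
    (hu : IsSymm u) (y : ({i // p i} → κ) → ℂ) : IsSymm (contract p y u) := fun π e =>
  Finset.sum_congr rfl fun F _ => congrArg _ (hu.join_right p F π e)

theorem amp_mul_amp [Fintype κ] [DecidableEq ι] [Fintype ι] [Fintype {i // p i}] (x : κ → ℂ)
    (y : ({i // p i} → κ) → ℂ) (w : ({i // ¬p i} → κ) → ℂ) :
    amp x y * amp x w = amp x fun f => y ((join p).symm f).1 * w ((join p).symm f).2 := by
  rw [amp.eq_1 x fun f => y ((join p).symm f).1 * w ((join p).symm f).2,
    ← (join p).sum_comp, Fintype.sum_prod_type, amp, amp, Finset.sum_mul_sum]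
  refine Finset.sum_congr rfl fun F _ => Finset.sum_congr rfl fun e _ => ?_
  rw [pw_join, Equiv.symm_apply_apply, star_mul']
  ring

end Join

/-! ### The comparison inequality for symmetric vectors. -/

theorem norm_sq_sub_eq (α β : ℝ) (a b : ℂ) :
    ‖(α : ℂ) * a - β * b‖ ^ 2 =
      α ^ 2 * ‖a‖ ^ 2 + β ^ 2 * ‖b‖ ^ 2 - 2 * (α * β) * (b * star a).re := by
  simp only [Complex.sq_norm, Complex.normSq_apply, Complex.sub_re, Complex.sub_im,
    Complex.mul_re, Complex.mul_im, Complex.ofReal_re, Complex.ofReal_im, Complex.star_def,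
    Complex.conj_re, Complex.conj_im]
  ring

theorem integral_norm_amp_sq (hd : 1 ≤ d) {ι : Type} [Fintype ι] [DecidableEq ι]
    {u : (ι → Fin d × Fin d) → ℂ} (hu : IsSymm u) :
    (symNum d (Fintype.card ι) : ℝ) * ∫ Ψ, ‖amp (Ψ : K d) u‖ ^ 2 ∂(haar d) =
      ∑ f, ‖u f‖ ^ 2 := by
  have h := integral_amp_mul_star_amp hd hu (v := u)
  simp_rw [Complex.star_def, Complex.mul_conj'] at h
  have h2 : ∫ Ψ, ((‖amp (Ψ : K d) u‖ : ℂ)) ^ 2 ∂(haar d) =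
      ((∫ Ψ, ‖amp (Ψ : K d) u‖ ^ 2 ∂(haar d) : ℝ) : ℂ) := by
    rw [← integral_complex_ofReal]
    push_cast
    rfl
  rw [h2] at h
  exact_mod_cast h

/-- The square root comparison: the reduced coherent-state average of a symmetric vector dominates
a multiple close to one of its reduced operator. -/
theorem contract_le_integral (hd : 1 ≤ d) {ι : Type} [Fintype ι] [DecidableEq ι]
    (p : ι → Prop) [DecidablePred p] [Fintype {i // p i}] {u : (ι → Fin d × Fin d) → ℂ} (hu : IsSymm u)
    (y : ({i // p i} → Fin d × Fin d) → ℂ) :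
    (2 * √((symNum d (Fintype.card {i // ¬p i}) : ℝ) / symNum d (Fintype.card ι)) - 1) *
        ∑ e, ‖contract p y u e‖ ^ 2 ≤
      symNum d (Fintype.card ι) *
        ∫ Ψ, ‖amp (Ψ : K d) u‖ ^ 2 * ‖amp (Ψ : K d) y‖ ^ 2 ∂(haar d) := by
  set w := contract p y u with hwdef
  have hw : IsSymm w := hu.contract p y
  set D : ℝ := (symNum d (Fintype.card ι) : ℝ) with hD
  set D' : ℝ := (symNum d (Fintype.card {i // ¬p i}) : ℝ) with hD'
  have hD0 : 0 < D := by rw [hD]; exact_mod_cast symNum_pos _ _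
  have hD'0 : 0 < D' := by rw [hD']; exact_mod_cast symNum_pos _ _
  set X : ℝ := ∑ e, ‖w e‖ ^ 2 with hX
  have haa := integral_norm_amp_sq hd hw
  rw [← hD', ← hX] at haa
  -- `a` and `b` are the two candidates for an amplitude of the partial inner product; with weights
  -- √D' and √D their squared norms give the two sides of the inequality.
  let a : UnitVec d → ℂ := fun Ψ => amp (Ψ : K d) w
  let b : UnitVec d → ℂ := fun Ψ => amp (Ψ : K d) u * star (amp (Ψ : K d) y)
  have hca : Continuous a := continuous_amp w
  have hcb : Continuous b := (continuous_amp u).mul (continuous_amp y).star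
  -- The cross term is exact: the amplitudes of y and w multiply to that of y ⊗ w, so the resolution
  -- of the identity in full degree yields ⟨y ⊗ w | u⟩ = ‖w‖².
  have hba : D * ∫ Ψ, (b Ψ * star (a Ψ)).re ∂(haar d) = X := by
    have h := integral_amp_mul_star_amp hd hu
      (v := fun f => y ((join p).symm f).1 * w ((join p).symm f).2)
    have h1 : ∀ Ψ : UnitVec d, b Ψ * star (a Ψ) = amp (Ψ : K d) u *
        star (amp (Ψ : K d) fun f => y ((join p).symm f).1 * w ((join p).symm f).2) := by
      intro Ψ
      rw [← amp_mul_amp, star_mul', ← mul_assoc]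
    simp_rw [← h1] at h
    rw [← (join p).sum_comp, Fintype.sum_prod_type, Finset.sum_comm] at h
    have h2 : ∀ e, ∑ F, u (join p (F, e)) *
        star (y ((join p).symm (join p (F, e))).1 * w ((join p).symm (join p (F, e))).2) =
        ((‖w e‖ ^ 2 : ℝ) : ℂ) := by
      intro e
      simp only [Equiv.symm_apply_apply]
      push_cast
      rw [← Complex.mul_conj']
      have hwe : w e = ∑ F, star (y F) * u (join p (F, e)) := rfl
      rw [hwe, Finset.sum_mul, ← hwe]
      refine Finset.sum_congr rfl fun F _ => ?_
      simp only [star_mul', Complex.star_def]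
      ring
    rw [Finset.sum_congr rfl fun e _ => h2 e] at h
    have h3 := integral_re (𝕜 := ℂ) (integrable_haar hd (hcb.mul hca.star))
    have h4 := congrArg Complex.re h
    rw [← Complex.ofReal_natCast, Complex.re_ofReal_mul, ← Complex.ofReal_sum,
      Complex.ofReal_re] at h4
    rw [hX, ← h4]
    congr 1
  have hbb : ∀ Ψ, ‖b Ψ‖ ^ 2 = ‖amp (Ψ : K d) u‖ ^ 2 * ‖amp (Ψ : K d) y‖ ^ 2 := by
    intro Ψ
    rw [norm_mul, norm_star, mul_pow]
  have hpos : 0 ≤ ∫ Ψ, ‖(√D' : ℂ) * a Ψ - (√D : ℂ) * b Ψ‖ ^ 2 ∂(haar d) :=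
    integral_nonneg fun Ψ => by positivity
  simp_rw [norm_sq_sub_eq, Real.sq_sqrt hD0.le, Real.sq_sqrt hD'0.le] at hpos
  rw [integral_sub, integral_add, integral_const_mul, integral_const_mul,
    integral_const_mul] at hpos
  · simp_rw [hbb] at hpos
    rw [haa] at hpos
    have hre : ∫ Ψ, (b Ψ * star (a Ψ)).re ∂(haar d) = X / D := by
      rw [eq_div_iff hD0.ne', mul_comm, hba]
    rw [hre] at hpos
    have hs : √(D' / D) = √D' * √D / D := by
      rw [Real.sqrt_div' _ hD0.le, div_eq_div_iff (Real.sqrt_ne_zero'.2 hD0) hD0.ne', mul_assoc,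
        Real.mul_self_sqrt hD0.le]
    rw [hs]
    have : 2 * (√D' * √D) * (X / D) = 2 * (√D' * √D / D) * X := by ring
    linarith
  · exact integrable_haar hd (continuous_const.mul (hca.norm.pow 2))
  · exact integrable_haar hd (continuous_const.mul (hcb.norm.pow 2))
  · exact (integrable_haar hd (continuous_const.mul (hca.norm.pow 2))).add
      (integrable_haar hd (continuous_const.mul (hcb.norm.pow 2)))
  · exact integrable_haar hd
      (continuous_const.mul (Complex.continuous_re.comp (hcb.mul hca.star)))

/-! ### Estimates for `bigS`. -/

theorem choose_add_ratio (N n k : ℕ) :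
    (((N + n).choose n : ℕ) : ℝ) / (((N + (n + k)).choose (n + k) : ℕ) : ℝ) =
      ∏ j ∈ Finset.range N, (1 - (k : ℝ) / ((n + k : ℕ) + (j + 1 : ℕ))) := by
  induction N with
  | zero => simp
  | succ N ih =>
    rw [Finset.prod_range_succ, ← ih]
    have h (n : ℕ) : ((N + 1 : ℕ) : ℝ) * ((N + 1 + n).choose n : ℕ) =
        (n + (N + 1 : ℕ)) * ((N + n).choose n : ℕ) := by
      have h1 := Nat.add_one_mul_choose_eq (N + n) N
      rw [Nat.choose_symm_add, show N + n + 1 = (N + 1) + n by ring, Nat.choose_symm_add] at h1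
      have h2 : (N + 1 + n) * (N + n).choose n = (N + 1 + n).choose n * (N + 1) := h1
      have h3 : ((N + 1 + n : ℕ) : ℝ) * ((N + n).choose n : ℕ) =
        ((N + 1 + n).choose n : ℕ) * (N + 1 : ℕ) := by exact_mod_cast h2
      push_cast at h3 ⊢
      linarith
    have hn := h n
    have hm := h (n + k)
    have p1 : (0 : ℝ) < ((N + (n + k)).choose (n + k) : ℕ) := by
      exact_mod_cast Nat.choose_pos (by omega)
    have p2 : (0 : ℝ) < ((N + 1 + (n + k)).choose (n + k) : ℕ) := by
      exact_mod_cast Nat.choose_pos (by omega)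
    push_cast at hn hm ⊢
    have p3 : (0 : ℝ) < (n : ℝ) + k + (N + 1) := by positivity
    have p4 : (0 : ℝ) < (N : ℝ) + 1 := by positivity
    have e1 : (((N + 1 + n).choose n : ℕ) : ℝ) =
        (n + (N + 1)) * ((N + n).choose n : ℕ) / (N + 1) := by
      rw [eq_div_iff p4.ne', ← hn]; ring
    have e2 : (((N + 1 + (n + k)).choose (n + k) : ℕ) : ℝ) =
        (n + k + (N + 1)) * ((N + (n + k)).choose (n + k) : ℕ) / (N + 1) := by
      rw [eq_div_iff p4.ne', ← hm]; ring
    rw [e1, e2]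
    field_simp
    ring

theorem bigS_eq {d M k : ℕ} (hd : 1 ≤ d) (hk : k ≤ M) :
    bigS d M k = 1 - √(∏ j ∈ Finset.range (d * d - 1), (1 - (k : ℝ) / (M + (j + 1 : ℕ)))) := by
  obtain ⟨n, rfl⟩ := Nat.exists_eq_add_of_le' hk
  rw [bigS, symDim_eq _ _ hd, symDim_eq _ _ hd, Nat.add_sub_cancel, symNum, symNum,
    choose_add_ratio]

theorem cast_sq_sub_one {d : ℕ} (hd : 1 ≤ d) : ((d * d - 1 : ℕ) : ℝ) = (d : ℝ) ^ 2 - 1 := by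
  rw [Nat.cast_sub (Nat.mul_pos hd hd)]
  push_cast
  ring

theorem factor_nonneg {M k : ℕ} (hk : k ≤ M) (j : ℕ) :
    (0 : ℝ) ≤ 1 - (k : ℝ) / (M + (j + 1 : ℕ)) := by
  rw [sub_nonneg, div_le_one (by positivity)]
  have : (k : ℝ) ≤ M := by exact_mod_cast hk
  have : (0 : ℝ) ≤ (j + 1 : ℕ) := Nat.cast_nonneg _
  linarith

theorem bigS_nonneg {d M k : ℕ} (hd : 1 ≤ d) (hk : k ≤ M) : 0 ≤ bigS d M k := by
  rw [bigS_eq hd hk, sub_nonneg]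
  refine (Real.sqrt_le_sqrt ?_).trans_eq Real.sqrt_one

  refine Finset.prod_le_one (fun j _ => factor_nonneg hk j) fun j _ => ?_
  rw [sub_le_self_iff]
  positivity

theorem four_mul_bigS_le {d M k : ℕ} (hd : 1 ≤ d) (hk : k ≤ M) :
    4 * bigS d M k ≤ 2 * ((d : ℝ) ^ 2 - 1) * k / M := by
  -- For M = k = 0 the quotient by M is 0 by convention, and both sides vanish.
  rcases Nat.eq_zero_or_pos M with hM | hM
  · subst hM
    obtain rfl : k = 0 := by omega
    simp [bigS_eq hd hk]
  -- Bernoulli's inequality is applied with exponent (d² - 1)/2, which must be at least 1. This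
  -- holds for d ≥ 2; for d = 1 the product is empty and both sides are 0.
  rcases Nat.lt_or_ge d 2 with h2 | h2
  · obtain rfl : d = 1 := by omega
    simp [bigS_eq hd hk]
  have hM' : (0 : ℝ) < M := by exact_mod_cast hM
  have hkM : (k : ℝ) ≤ M := by exact_mod_cast hk
  have hx : (k : ℝ) / M ≤ 1 := (div_le_one hM').2 hkM
  have h1 : ((1 : ℝ) - k / M) ^ (d * d - 1) ≤
      ∏ j ∈ Finset.range (d * d - 1), (1 - (k : ℝ) / (M + (j + 1 : ℕ))) := by
    rw [← Finset.card_range (d * d - 1), ← Finset.prod_const, Finset.card_range]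
    refine Finset.prod_le_prod (fun _ _ => by linarith) fun j _ => ?_
    gcongr
    have : (0 : ℝ) ≤ (j + 1 : ℕ) := Nat.cast_nonneg _
    linarith
  have hN : (2 : ℝ) ≤ (d * d - 1 : ℕ) := by
    have : 4 ≤ d * d := Nat.mul_le_mul h2 h2
    exact_mod_cast (by omega : 2 ≤ d * d - 1)
  have h3 := one_add_mul_self_le_rpow_one_add (s := -((k : ℝ) / M)) (by linarith)
    (p := ((d * d - 1 : ℕ) : ℝ) / 2) (by linarith)
  have h4 : √(((1 : ℝ) - k / M) ^ (d * d - 1)) =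
      (1 + -((k : ℝ) / M)) ^ (((d * d - 1 : ℕ) : ℝ) / 2) := by
    rw [Real.sqrt_eq_rpow, ← Real.rpow_natCast, ← Real.rpow_mul (by linarith), sub_eq_add_neg,
      mul_one_div]
  have h5 := Real.sqrt_le_sqrt h1
  rw [h4] at h5
  rw [bigS_eq hd hk, ← cast_sq_sub_one hd]
  have : 2 * ((d * d - 1 : ℕ) : ℝ) * k / M = 4 * (((d * d - 1 : ℕ) : ℝ) / 2 * (k / M)) := by ring
  rw [this]
  linarith

theorem one_sub_exp_neg_ge {y : ℝ} (hy : 0 ≤ y) : y * (1 - y) ≤ 1 - Real.exp (-y) := by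
  have h : Real.exp (-y) ≤ 1 / (1 + y) := by
    rw [Real.exp_neg, ← one_div]
    exact one_div_le_one_div_of_le (by linarith) (by linarith [Real.add_one_le_exp y])
  have h2 : 1 / (1 + y) ≤ 1 - y * (1 - y) := by
    rw [div_le_iff₀ (by linarith)]
    nlinarith [mul_nonneg hy (mul_nonneg hy hy)]
  linarith

/-- Each factor is at most the last one, 1 - k/(M + d² - 1), and 1 - t ≤ e^{-t}; the square root
halves the exponent. -/
theorem bigS_ge {d M k : ℕ} (hd : 1 ≤ d) (hk : k ≤ M) :
    1 - Real.exp (-((d * d - 1 : ℕ) * (k / (M + (d * d - 1 : ℕ))) / 2)) ≤ bigS d M k := by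
  rw [bigS_eq hd hk]
  refine sub_le_sub_left ?_ _
  rw [Real.sqrt_le_left (Real.exp_pos _).le, ← Real.exp_nat_mul]
  calc _ ≤ ∏ _j ∈ Finset.range (d * d - 1), Real.exp (-(k / (M + (d * d - 1 : ℕ)))) := by
        refine Finset.prod_le_prod (fun j _ => factor_nonneg hk j) fun j hj => ?_
        refine le_trans ?_ (Real.one_sub_le_exp_neg _)
        have : ((j + 1 : ℕ) : ℝ) ≤ (d * d - 1 : ℕ) := by
          exact_mod_cast Finset.mem_range.1 hj
        gcongr
    _ = _ := by
        rw [Finset.prod_const, Finset.card_range, ← Real.exp_nat_mul]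
        congr 1
        push_cast
        ring

theorem bigS_asymptotic (ε : ℝ) (hε : 0 < ε) :
    ∃ C : ℝ, ∀ d M k : ℕ, 1 ≤ d → k ≤ M → C * (k * (d : ℝ) ^ 2) ≤ M →
      |4 * bigS d M k - 2 * ((d : ℝ) ^ 2 - 1) * k / M|
        ≤ ε * (2 * ((d : ℝ) ^ 2 - 1) * k / M) := by
  -- With N = d² - 1, this constant forces kN ≤ εM/2. Then y ≤ ε/4 controls the quadratic loss in 1
  -- - e^{-y}, and replacing M + N by M costs at most a relative ε/2; together the relative loss is
  -- at most 3ε/4.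
  refine ⟨2 / ε, fun d M k hd hk hC => ?_⟩
  have hup := four_mul_bigS_le hd hk
  rw [abs_sub_comm, abs_of_nonneg (sub_nonneg.2 hup)]
  rcases Nat.eq_zero_or_pos k with h0 | hkpos
  · subst h0
    have := bigS_nonneg hd hk
    simpa using this
  have hM' : (0 : ℝ) < M := by exact_mod_cast lt_of_lt_of_le hkpos hk
  have hk1 : (1 : ℝ) ≤ k := by exact_mod_cast hkpos
  have hlow := bigS_ge hd hk
  rw [← cast_sq_sub_one hd] at hup ⊢
  have hN : ((d * d - 1 : ℕ) : ℝ) ≤ (d : ℝ) ^ 2 := by rw [cast_sq_sub_one hd]; linarith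
  set N : ℝ := ((d * d - 1 : ℕ) : ℝ)
  have hN0 : 0 ≤ N := Nat.cast_nonneg _
  have hk0 : (0 : ℝ) < k := by linarith
  have hNk : 2 * (k * N) ≤ ε * M := by
    have : 2 / ε * (k * N) ≤ M := le_trans (by gcongr) hC
    rw [div_mul_eq_mul_div, div_le_iff₀ hε] at this
    linarith
  set y : ℝ := N * (k / (M + N)) / 2 with hy
  have hy0 : 0 ≤ y := by positivity
  have hexp := one_sub_exp_neg_ge hy0
  have hMN : 0 < (M : ℝ) + N := by linarith
  have hyle : y ≤ ε / 4 := by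
    rw [hy, div_le_iff₀ two_pos, ← mul_div_assoc, div_le_iff₀ hMN]
    nlinarith
  have hy2 : (1 - ε / 2) * (N * k / M) ≤ 2 * y := by
    rw [hy, mul_div_cancel₀ _ (two_ne_zero), ← mul_div_assoc, ← mul_div_assoc, div_le_div_iff₀ hM' hMN]
    have : (1 - ε / 2) * (M + N) ≤ M := by nlinarith
    have hNk0 : 0 ≤ N * k := by positivity
    nlinarith
  have hy3 : 2 * y ≤ N * k / M := by
    rw [hy, mul_div_cancel₀ _ (two_ne_zero), ← mul_div_assoc]
    gcongr
    linarith
  have e : 2 * N * k / M = 2 * (N * k / M) := by ring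
  rw [e]
  nlinarith

/-! ### The trace norm of Hermitian matrices. -/

theorem traceNorm_eq_sum_abs_eigenvalues {κ : Type} [Fintype κ] [DecidableEq κ] {A : Op κ}
    (hA : A.IsHermitian) : traceNorm A = ∑ i, |hA.eigenvalues i| := by
  have hB := Matrix.isHermitian_conjTranspose_mul_self A
  let U : Op κ := hA.eigenvectorUnitary
  have hU : star U * U = 1 := Unitary.coe_star_mul_self hA.eigenvectorUnitary
  have hsp : A = U * Matrix.diagonal (RCLike.ofReal ∘ hA.eigenvalues) * star U := by
    have := hA.spectral_theorem
    rwa [Unitary.conjStarAlgAut_apply] at this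
  have hsq : A.conjTranspose * A =
      U * Matrix.diagonal (fun i => ((hA.eigenvalues i ^ 2 : ℝ) : ℂ)) * star U := by
    rw [hA.eq]
    conv_lhs => rw [hsp]
    calc _ = U * Matrix.diagonal (RCLike.ofReal ∘ hA.eigenvalues) * (star U * U) *
          Matrix.diagonal (RCLike.ofReal ∘ hA.eigenvalues) * star U := by
          simp only [Matrix.mul_assoc]
      _ = _ := by
        rw [hU, Matrix.mul_one, Matrix.mul_assoc U, Matrix.diagonal_mul_diagonal]
        congr 3
        funext i
        simp [sq]
  -- The eigenvalues of A†A come in their own order, so they are matched with the squares of those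
  -- of A as multisets of roots of the characteristic polynomial.
  have hroots : (A.conjTranspose * A).charpoly.roots =
      Multiset.map (fun i => ((hA.eigenvalues i ^ 2 : ℝ) : ℂ)) Finset.univ.val := by
    rw [hsq, Matrix.charpoly_mul_comm, ← Matrix.mul_assoc, hU, Matrix.one_mul,
      Matrix.charpoly_diagonal]
    exact (congrArg Polynomial.roots (by rw [Multiset.map_map]; rfl)).trans
      (Polynomial.roots_multiset_prod_X_sub_C
        (Multiset.map (fun i => ((hA.eigenvalues i ^ 2 : ℝ) : ℂ)) Finset.univ.val))
  rw [hB.roots_charpoly_eq_eigenvalues] at hroots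
  have h2 := congrArg (fun s : Multiset ℂ => (s.map fun z => √z.re).sum) hroots
  simp only [Multiset.map_map, Function.comp_def] at h2
  rw [traceNorm]
  refine Eq.trans ?_ (h2.trans ?_)
  · rfl
  · show ∑ i, √(((hA.eigenvalues i ^ 2 : ℝ) : ℂ).re) = _
    simp [Real.sqrt_sq_eq_abs, -Complex.ofReal_pow]

/-- In an eigenbasis of A - B each eigenvalue is a difference of nonnegative diagonal entries of A
and B, hence bounded in absolute value by their sum. -/
theorem traceNorm_sub_le {κ : Type} [Fintype κ] [DecidableEq κ] {A B : Op κ}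
    (hA : A.PosSemidef) (hB : B.PosSemidef) :
    traceNorm (A - B) ≤ A.trace.re + B.trace.re := by
  have hH : (A - B).IsHermitian := hA.isHermitian.sub hB.isHermitian
  rw [traceNorm_eq_sum_abs_eigenvalues hH]
  let U : Op κ := hH.eigenvectorUnitary
  have hU : star U * U = 1 := Unitary.coe_star_mul_self hH.eigenvectorUnitary
  have hU' : U * star U = 1 := Unitary.coe_mul_star_self hH.eigenvectorUnitary
  have hsp : A - B = U * Matrix.diagonal (RCLike.ofReal ∘ hH.eigenvalues) * star U := by
    have := hH.spectral_theorem
    rwa [Unitary.conjStarAlgAut_apply] at this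
  have hdiag : star U * A * U - star U * B * U =
      Matrix.diagonal (RCLike.ofReal ∘ hH.eigenvalues) := by
    rw [← Matrix.sub_mul, ← Matrix.mul_sub]
    calc _ = star U * (U * Matrix.diagonal (RCLike.ofReal ∘ hH.eigenvalues) * star U) * U :=
          congrArg (fun Z => star U * Z * U) hsp
      _ = (star U * U) * Matrix.diagonal (RCLike.ofReal ∘ hH.eigenvalues) * (star U * U) := by
          simp only [Matrix.mul_assoc]
      _ = _ := by rw [hU, Matrix.one_mul, Matrix.mul_one]
  have htr (C : Op κ) : C.trace.re = ∑ i, ((star U * C * U) i i).re := by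
    rw [← Complex.re_sum]
    congr 1
    show _ = (star U * C * U).trace
    rw [Matrix.trace_mul_comm, ← Matrix.mul_assoc, hU', Matrix.one_mul]
  rw [htr A, htr B, ← Finset.sum_add_distrib]
  refine Finset.sum_le_sum fun i _ => ?_
  have hi := congrArg Complex.re (congrFun (congrFun hdiag i) i)
  have ha : 0 ≤ ((star U * A * U) i i).re :=
    (Complex.le_def.1 ((hA.conjTranspose_mul_mul_same U).diag_nonneg (i := i))).1
  have hb : 0 ≤ ((star U * B * U) i i).re :=
    (Complex.le_def.1 ((hB.conjTranspose_mul_mul_same U).diag_nonneg (i := i))).1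
  rw [Matrix.diagonal_apply_eq, Matrix.sub_apply, Complex.sub_re] at hi
  have hi' : ((star U * A * U) i i).re - ((star U * B * U) i i).re = hH.eigenvalues i := hi
  rw [← hi', abs_le]
  constructor <;> linarith

/-! ### The Choi matrix and the symmetric purification. -/

/-- Positive matrices span all matrices, and a nonzero positive one is a multiple of a state, so the
invariance extends by linearity. This is needed for matrix units, which are not states in general.
-/
theorem IsSDIChannel.perm_invariant_apply {d m M : ℕ} {E : Op (Fin m) →CP OpPow d M}
    (hE : IsSDIChannel E) (X : Op (Fin m)) : IsPermInvariant (E X) := by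
  have hX : X ∈ Submodule.span ℂ {a : Op (Fin m) | 0 ≤ a} := by
    rw [CStarAlgebra.span_nonneg]
    trivial
  induction hX using Submodule.span_induction with
  | mem x hx =>
    have hx' : x.PosSemidef := Matrix.nonneg_iff_posSemidef.1 hx
    by_cases h0 : x.trace = 0
    · rw [hx'.trace_eq_zero_iff.1 h0, map_zero]
      exact fun π => rfl
    · have hs : IsState (x.trace⁻¹ • x) :=
        ⟨hx'.smul (inv_nonneg.2 hx'.trace_nonneg), by
          rw [Matrix.trace_smul, smul_eq_mul, inv_mul_cancel₀ h0]⟩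
      have h := hE.perm_invariant _ hs
      intro π
      have h2 := h π
      rw [map_smul, Matrix.submatrix_smul] at h2
      exact smul_right_injective _ (inv_ne_zero h0) h2
  | zero => rw [map_zero]; exact fun π => rfl
  | add x y _ _ hx hy =>
    intro π
    rw [map_add, Matrix.submatrix_add]
    exact congrArg₂ (· + ·) (hx π) (hy π)
  | smul c x _ hx =>
    intro π
    rw [map_smul, Matrix.submatrix_smul]
    exact congrArg (c • ·) (hx π)

/-- The Choi matrix of a completely positive map. -/
def choi {d m M : ℕ} (E : Op (Fin m) →CP OpPow d M) : Op ((Fin M → Fin d) × Fin m) :=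
  Matrix.of fun x y => E (Matrix.single x.2 y.2 1) x.1 y.1

/-- A matrix of matrices as a single matrix. -/
def flatten {d m M : ℕ} (Z : CStarMatrix (Fin m) (Fin m) (OpPow d M)) :
    Op ((Fin M → Fin d) × Fin m) :=
  Matrix.of fun x y => Z x.2 y.2 x.1 y.1

theorem flatten_posSemidef {d m M : ℕ} {Z : CStarMatrix (Fin m) (Fin m) (OpPow d M)}
    (hZ : 0 ≤ Z) : (flatten Z).PosSemidef := by
  rw [StarOrderedRing.nonneg_iff] at hZ
  induction hZ using AddSubmonoid.closure_induction with
  | mem Z hZ =>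
    obtain ⟨L, rfl⟩ := hZ
    let B : Matrix (Fin m × (Fin M → Fin d)) ((Fin M → Fin d) × Fin m) ℂ :=
      Matrix.of fun y x => L y.1 x.2 y.2 x.1
    have : flatten (star L * L) = B.conjTranspose * B := by
      ext x y
      rw [flatten, Matrix.of_apply, CStarMatrix.mul_apply, Matrix.sum_apply, Matrix.mul_apply,
        Fintype.sum_prod_type]
      rfl
    simp only [this]
    exact Matrix.posSemidef_conjTranspose_mul_self B
  | zero => exact Matrix.PosSemidef.zero
  | add Y Z _ _ hY hZ => exact hY.add hZ

theorem choi_posSemidef {d m M : ℕ} (E : Op (Fin m) →CP OpPow d M) : (choi E).PosSemidef := by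
  rcases Nat.eq_zero_or_pos m with hm | hm
  · subst hm
    have : choi E = 0 := by
      ext x
      exact x.2.elim0
    rw [this]
    exact Matrix.PosSemidef.zero
  let z : Fin m := ⟨0, hm⟩
  -- A block matrix with a single nonzero row, chosen so that N†N has the matrix unit e_{ab} as its
  -- block (a, b); complete positivity then applies to this manifestly positive element.
  let N : CStarMatrix (Fin m) (Fin m) (Op (Fin m)) :=
    CStarMatrix.ofMatrix (Matrix.of fun c b => if c = z then Matrix.single z b 1 else 0)
  have hN := E.map_cstarMatrix_nonneg (star N * N) (star_mul_self_nonneg N)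
  have hNe : ∀ a b, (star N * N) a b = Matrix.single a b 1 := by
    intro a b
    rw [CStarMatrix.mul_apply, Finset.sum_eq_single z]
    · show star (if z = z then Matrix.single z a (1 : ℂ) else 0) *
        (if z = z then Matrix.single z b (1 : ℂ) else 0) = _
      rw [if_pos rfl, if_pos rfl, Matrix.star_eq_conjTranspose, Matrix.conjTranspose_single,
        Matrix.single_mul_single_same]
      simp
    · intro c _ hc
      show star (if c = z then Matrix.single z a (1 : ℂ) else 0) *
        (if c = z then Matrix.single z b (1 : ℂ) else 0) = _
      rw [if_neg hc, if_neg hc, mul_zero]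
    · simp
  have hmap : choi E = flatten ((star N * N).map E) := by
    ext x y
    simp only [choi, flatten, Matrix.of_apply, CStarMatrix.map_apply, hNe]
  rw [hmap]
  exact flatten_posSemidef hN

/-- The Choi matrix of a channel with permutation-invariant outputs has a decomposition into
totally symmetric vectors of `K^{⊗M}`: a symmetric purification of the channel. -/
theorem IsSDIChannel.exists_purification {d m M : ℕ} {E : Op (Fin m) →CP OpPow d M}
    (hE : IsSDIChannel E) :
    ∃ v : Fin m → Fin m → (Fin M → Fin d × Fin d) → ℂ, (∀ c a, IsSymm (v c a)) ∧
      ∀ a b F G, E (Matrix.single a b 1) F G =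
        ∑ c, ∑ H : Fin M → Fin d, v c a (fun i => (F i, H i)) * star (v c b fun i => (G i, H i)) := by
  have hR : (0 : Op ((Fin M → Fin d) × Fin m)) ≤ choi E :=
    Matrix.nonneg_iff_posSemidef.2 (choi_posSemidef E)
  set T := CFC.sqrt (choi E) with hT
  have hT0 : T.PosSemidef := Matrix.nonneg_iff_posSemidef.1 (CFC.sqrt_nonneg _)
  have hTT : T * T = choi E := CFC.sqrt_mul_sqrt_self _ hR
  have hTπ : ∀ π : Equiv.Perm (Fin M), T.submatrix (fun x => (x.1 ∘ π, x.2))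
      (fun x => (x.1 ∘ π, x.2)) = T := by
    intro π
    let e : (Fin M → Fin d) × Fin m ≃ (Fin M → Fin d) × Fin m :=
      (Equiv.arrowCongr π.symm (Equiv.refl _)).prodCongr (Equiv.refl _)
    show T.submatrix e e = T
    -- The permuted root is again a positive root of the invariant Choi matrix, hence equal to `T`.
    refine (CFC.sqrt_unique ?_ (Matrix.nonneg_iff_posSemidef.2 (hT0.submatrix e))).symm
    rw [Matrix.submatrix_mul_equiv, hTT]
    ext x y
    exact congrFun (congrFun (hE.perm_invariant_apply (Matrix.single x.2 y.2 1) π) x.1) y.1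
  -- The column index of the root, a basis vector of H^{⊗M} together with `c`, serves as the
  -- purifying system. Permuting rows and columns simultaneously permutes the factors of K^{⊗M}, so
  -- invariance of `T` is symmetry of these tensors.
  refine ⟨fun c a h => T (fun i => (h i).1, a) (fun i => (h i).2, c), fun c a π h => ?_,
    fun a b F G => ?_⟩
  · exact congrFun (congrFun (hTπ π) (fun i => (h i).1, a)) (fun i => (h i).2, c)
  · have h := congrFun (congrFun hTT (F, a)) (G, b)
    rw [choi, Matrix.of_apply] at h
    rw [← h, Matrix.mul_apply, Fintype.sum_prod_type, Finset.sum_comm]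
    refine Finset.sum_congr rfl fun c _ => Finset.sum_congr rfl fun H _ => ?_
    congr 1
    exact (congrFun (congrFun hT0.isHermitian.eq (H, c)) (G, b)).symm

/-! ### Reduced operators and quadratic forms. -/

/-- The pairing of a basis vector of `H^{⊗ι}` with one of the purifying system. -/
abbrev zip {ι α β : Type} (F : ι → α) (H : ι → β) : ι → α × β := fun i => (F i, H i)

theorem zip_join {ι α β : Type} (p : ι → Prop) [DecidablePred p] (F : {i // p i} → α)
    (F' : {i // ¬p i} → α) (H : {i // p i} → β) (H' : {i // ¬p i} → β) :
    zip (join p (F, F')) (join p (H, H')) = join p (zip F H, zip F' H') := by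
  funext i
  by_cases hi : p i <;> simp [zip, hi]

theorem sum_zip {ι α β R : Type} [Fintype ι] [DecidableEq ι] [Fintype α] [Fintype β]
    [AddCommMonoid R] (φ : (ι → α × β) → R) :
    ∑ f, φ f = ∑ F : ι → α, ∑ H : ι → β, φ (zip F H) := by
  rw [← Fintype.sum_prod_type', ← (Equiv.arrowProdEquivProdArrow ι (fun _ => α) fun _ => β).symm.sum_comp]
  rfl

theorem trace_traceSnd {α β : Type} [Fintype α] [Fintype β] (X : Op (α × β)) :
    (traceSnd X).trace = X.trace := by
  simp only [Matrix.trace, Matrix.diag_apply, traceSnd, Matrix.of_apply, Fintype.sum_prod_type]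

theorem trace_reduced {M : ℕ} (S : Finset (Fin M)) (X : OpPow d M) :
    (reduced S X).trace = X.trace := by
  rw [reduced, trace_traceSnd]
  exact (join fun i => i ∈ S).sum_comp fun f => X f f

theorem reduced_apply {M : ℕ} (S : Finset (Fin M)) (X : OpPow d M) (F G) :
    reduced S X F G = ∑ e, X (join (fun i => i ∈ S) (F, e)) (join (fun i => i ∈ S) (G, e)) := rfl

theorem isHermitian_reduced {M : ℕ} (S : Finset (Fin M)) {X : OpPow d M} (hX : X.IsHermitian) :
    (reduced S X).IsHermitian := by
  ext F G
  rw [Matrix.conjTranspose_apply, reduced_apply, reduced_apply, star_sum]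
  exact Finset.sum_congr rfl fun e _ => hX.apply _ _

theorem rhoOf_apply (Ψ : UnitVec d) (a b : Fin d) :
    rhoOf Ψ a b = ∑ h, (Ψ : K d) (a, h) * star ((Ψ : K d) (b, h)) := rfl

theorem isHermitian_rhoOf (Ψ : UnitVec d) : (rhoOf Ψ).IsHermitian := by
  ext a b
  rw [Matrix.conjTranspose_apply, rhoOf_apply, rhoOf_apply, star_sum]
  refine Finset.sum_congr rfl fun h _ => ?_
  rw [star_mul', star_star, mul_comm]

theorem trace_rhoOf (Ψ : UnitVec d) : (rhoOf Ψ).trace = 1 := by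
  have h : ‖(Ψ : K d)‖ ^ 2 = 1 := by simp
  rw [EuclideanSpace.norm_sq_eq] at h
  rw [rhoOf, trace_traceSnd]
  have h2 := congrArg (fun r : ℝ => (r : ℂ)) h
  simp only [Complex.ofReal_sum, Complex.ofReal_pow, ← Complex.mul_conj', Complex.ofReal_one] at h2
  exact h2

theorem prod_rhoOf {ι : Type} [Fintype ι] [DecidableEq ι] (Ψ : UnitVec d) (F G : ι → Fin d) :
    ∏ i, rhoOf Ψ (F i) (G i) =
      ∑ h : ι → Fin d, pw (Ψ : K d) (zip F h) * star (pw (Ψ : K d) (zip G h)) := by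
  simp_rw [rhoOf_apply]
  rw [Finset.prod_univ_sum, Fintype.piFinset_univ]
  refine Finset.sum_congr rfl fun h _ => ?_
  rw [Finset.prod_mul_distrib, pw, pw, star_prod]

theorem sum_prod_rhoOf {ι : Type} [Fintype ι] [DecidableEq ι] (Ψ : UnitVec d) :
    ∑ e : ι → Fin d, ∏ i, rhoOf Ψ (e i) (e i) = 1 := by
  have h := Finset.prod_univ_sum (fun _ : ι => (Finset.univ : Finset (Fin d)))
    fun _ a => rhoOf Ψ a a
  rw [Fintype.piFinset_univ] at h
  rw [← h]
  have h1 : ∑ a, rhoOf Ψ a a = 1 := trace_rhoOf Ψ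
  simp [h1]

theorem continuous_rhoOf (a b : Fin d) : Continuous fun Ψ : UnitVec d => rhoOf Ψ a b := by
  simp_rw [rhoOf_apply]
  refine continuous_finsetSum _ fun h _ => ?_
  fun_prop

theorem continuous_prod_rhoOf {ι : Type} [Fintype ι] (F G : ι → Fin d) :
    Continuous fun Ψ : UnitVec d => ∏ i, rhoOf Ψ (F i) (G i) :=
  continuous_finsetProd _ fun i _ => continuous_rhoOf (F i) (G i)

theorem reduced_tensorPow {M : ℕ} (S : Finset (Fin M)) (Ψ : UnitVec d) (F G) :
    reduced S (tensorPow M (rhoOf Ψ)) F G = ∏ i, rhoOf Ψ (F i) (G i) := by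
  rw [reduced_apply]
  have h (e) : tensorPow M (rhoOf Ψ) (join (fun i => i ∈ S) (F, e)) (join (fun i => i ∈ S) (G, e)) =
      (∏ i, rhoOf Ψ (F i) (G i)) * ∏ i, rhoOf Ψ (e i) (e i) :=
    prod_join (fun i => i ∈ S) (fun a b => rhoOf Ψ a b) F e G e
  rw [Finset.sum_congr rfl fun e _ => h e, ← Finset.mul_sum, sum_prod_rhoOf, mul_one]

theorem tensorPow_apply {M : ℕ} (σ : Op (Fin d)) (F G : Fin M → Fin d) :
    tensorPow M σ F G = ∏ i, σ (F i) (G i) := rfl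

/-- The tensor `x ⊗ e_h` on the purified factors. -/
def lift {ι : Type} (x : (ι → Fin d) → ℂ) (h : ι → Fin d) : (ι → Fin d × Fin d) → ℂ := by
  classical
  exact fun f => if (fun i => (f i).2) = h then x fun i => (f i).1 else 0

theorem lift_zip {ι : Type} [DecidableEq (ι → Fin d)] (x : (ι → Fin d) → ℂ) (h F H : ι → Fin d) :
    lift x h (zip F H) = if H = h then x F else 0 := by
  simp only [lift]

theorem amp_lift {ι : Type} [Fintype ι] [DecidableEq ι] (Ψ : UnitVec d)
    (x : (ι → Fin d) → ℂ) (h : ι → Fin d) :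
    amp (Ψ : K d) (lift x h) = ∑ F, star (pw (Ψ : K d) (zip F h)) * x F := by
  rw [amp, sum_zip]
  simp [lift_zip]

theorem contract_lift {ι : Type} [DecidableEq ι] (p : ι → Prop) [DecidablePred p]
    [Fintype {i // p i}] (x : ({i // p i} → Fin d) → ℂ) (h : {i // p i} → Fin d) (u : (ι → Fin d × Fin d) → ℂ)
    (e : {i // ¬p i} → Fin d × Fin d) :
    contract p (lift x h) u e = ∑ F, star (x F) * u (join p (zip F h, e)) := by
  rw [contract, sum_zip]
  simp [lift_zip, apply_ite star]

theorem dotProduct_mulVec_eq {κ : Type} [Fintype κ] (A : Op κ) (x : κ → ℂ) :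
    star x ⬝ᵥ A.mulVec x = ∑ F, ∑ G, star (x F) * A F G * x G := by
  simp only [dotProduct, Matrix.mulVec, Finset.mul_sum, Pi.star_apply, mul_assoc]

/-- Turns operator inequalities between reduced states into scalar inequalities between sums of
squared norms. -/
theorem quadForm_gram {κ τ : Type} [Fintype κ] [Fintype τ] (g : τ → κ → ℂ) (x : κ → ℂ) :
    ∑ F, ∑ G, star (x F) * (∑ t, g t F * star (g t G)) * x G =
      ((∑ t, ‖∑ F, star (x F) * g t F‖ ^ 2 : ℝ) : ℂ) := by
  push_cast
  simp_rw [← Complex.mul_conj', ← Complex.star_def, star_sum, Finset.sum_mul_sum, Finset.mul_sum,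
    Finset.sum_mul]
  refine (Finset.sum_congr rfl fun F _ => Finset.sum_comm).trans (Finset.sum_comm.trans ?_)
  refine Finset.sum_congr rfl fun t _ => Finset.sum_congr rfl fun F _ =>
    Finset.sum_congr rfl fun G _ => ?_
  rw [star_mul', star_star]
  ring

/-! ### Comparison of the reduced outputs for a family of symmetric vectors. -/

section Family

variable {M : ℕ} {γ : Type} [Fintype γ] (u : γ → (Fin M → Fin d × Fin d) → ℂ)

/-- Tracing out the purifying factors of the users in `S` is a sum over the test vectors x ⊗ e_h;
tracing out everything else gives the squared norm of the contraction. -/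
theorem quadForm_reduced_purified (S : Finset (Fin M)) {X : OpPow d M}
    (hX : ∀ F G, X F G = ∑ j, ∑ H : Fin M → Fin d, u j (zip F H) * star (u j (zip G H)))
    (x : ({i // i ∈ S} → Fin d) → ℂ) :
    star x ⬝ᵥ (reduced S X).mulVec x =
      ((∑ h, ∑ j, ∑ e, ‖contract (fun i => i ∈ S) (lift x h) (u j) e‖ ^ 2 : ℝ) : ℂ) := by
  have h1 : ∀ F G, reduced S X F G = ∑ h : {i // i ∈ S} → Fin d, ∑ j, ∑ e,
      u j (join (fun i => i ∈ S) (zip F h, e)) * star (u j (join (fun i => i ∈ S) (zip G h, e))) := by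
    intro F G
    rw [reduced_apply]
    simp_rw [hX]
    have h2 : ∀ e : {i // ¬i ∈ S} → Fin d, ∑ j, ∑ H : Fin M → Fin d,
        u j (zip (join (fun i => i ∈ S) (F, e)) H) * star (u j (zip (join (fun i => i ∈ S) (G, e)) H)) =
        ∑ j, ∑ h : {i // i ∈ S} → Fin d, ∑ e' : {i // ¬i ∈ S} → Fin d,
          u j (join (fun i => i ∈ S) (zip F h, zip e e')) * star (u j (join (fun i => i ∈ S) (zip G h, zip e e'))) := by
      intro e
      refine Finset.sum_congr rfl fun j _ => ?_
      rw [← (join (fun i => i ∈ S)).sum_comp, Fintype.sum_prod_type]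
      simp_rw [zip_join]
    refine (Finset.sum_congr rfl fun e _ => h2 e).trans ?_
    rw [Finset.sum_comm]
    conv_rhs => rw [Finset.sum_comm]
    refine Finset.sum_congr rfl fun j _ => ?_
    rw [Finset.sum_comm]
    refine Finset.sum_congr rfl fun h _ => ?_
    rw [sum_zip]
  rw [dotProduct_mulVec_eq]
  have h3 := quadForm_gram
    (fun (t : ({i // i ∈ S} → Fin d) × γ × ({i // ¬i ∈ S} → Fin d × Fin d)) F =>
      u t.2.1 (join (fun i => i ∈ S) (zip F t.1, t.2.2))) x
  simp only [Fintype.sum_prod_type, ← contract_lift] at h3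
  refine Eq.trans ?_ h3
  refine Finset.sum_congr rfl fun F _ => Finset.sum_congr rfl fun G _ => ?_
  rw [h1]

theorem quadForm_reduced_measured (hd : 1 ≤ d) (S : Finset (Fin M)) {Y : OpPow d M}
    {q : UnitVec d → ℝ} (hq : Continuous q)
    (hY : ∀ F G, Y F G = ∫ Ψ, (q Ψ : ℂ) * tensorPow M (rhoOf Ψ) F G ∂(haar d))
    (x : ({i // i ∈ S} → Fin d) → ℂ) :
    star x ⬝ᵥ (reduced S Y).mulVec x =
      ((∑ h, ∫ Ψ, q Ψ * ‖amp (Ψ : K d) (lift x h)‖ ^ 2 ∂(haar d) : ℝ) : ℂ) := by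
  have hq' : Continuous fun Ψ => (q Ψ : ℂ) := Complex.continuous_ofReal.comp hq
  have h1 : ∀ F G, reduced S Y F G =
      ∫ Ψ, (q Ψ : ℂ) * ∏ i, rhoOf Ψ (F i) (G i) ∂(haar d) := by
    intro F G
    rw [reduced_apply]
    simp_rw [hY]
    rw [← integral_sum_haar hd (F := fun e Ψ => (q Ψ : ℂ) * tensorPow M (rhoOf Ψ)
      (join (fun i => i ∈ S) (F, e)) (join (fun i => i ∈ S) (G, e)))
      fun e => hq'.mul (continuous_prod_rhoOf (join (fun i => i ∈ S) (F, e)) (join (fun i => i ∈ S) (G, e)))]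
    congr 1
    funext Ψ
    rw [← Finset.mul_sum, ← reduced_apply, reduced_tensorPow]
  rw [dotProduct_mulVec_eq]
  simp_rw [h1]
  have h2 : ∀ F G : {i // i ∈ S} → Fin d,
      star (x F) * (∫ Ψ, (q Ψ : ℂ) * ∏ i, rhoOf Ψ (F i) (G i) ∂(haar d)) * x G =
      ∫ Ψ, star (x F) * ((q Ψ : ℂ) * ∏ i, rhoOf Ψ (F i) (G i)) * x G ∂(haar d) := by
    intro F G
    rw [integral_mul_const, integral_const_mul]
  have hc : ∀ F G : {i // i ∈ S} → Fin d, Continuous fun Ψ : UnitVec d =>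
      star (x F) * ((q Ψ : ℂ) * ∏ i, rhoOf Ψ (F i) (G i)) * x G := fun F G =>
    (continuous_const.mul (hq'.mul (continuous_prod_rhoOf F G))).mul continuous_const
  simp_rw [h2]
  simp_rw [fun F => (integral_sum_haar hd (hc F)).symm]
  rw [← integral_sum_haar hd fun F => continuous_finsetSum _ fun G _ => hc F G]
  have h3 : ∀ Ψ : UnitVec d, ∑ F, ∑ G, star (x F) * ((q Ψ : ℂ) * ∏ i, rhoOf Ψ (F i) (G i)) * x G =
      ((∑ h, q Ψ * ‖amp (Ψ : K d) (lift x h)‖ ^ 2 : ℝ) : ℂ) := by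
    intro Ψ
    have h4 := quadForm_gram (fun h F => pw (Ψ : K d) (zip F h)) x
    have h5 : ∀ h, ‖∑ F, star (x F) * pw (Ψ : K d) (zip F h)‖ = ‖amp (Ψ : K d) (lift x h)‖ := by
      intro h
      rw [← norm_star, star_sum, amp_lift]
      congr 1
      refine Finset.sum_congr rfl fun F _ => ?_
      rw [star_mul', star_star, mul_comm]
    simp_rw [h5] at h4
    rw [← Finset.mul_sum, Complex.ofReal_mul, ← h4, Finset.mul_sum]
    refine Finset.sum_congr rfl fun F _ => ?_
    rw [Finset.mul_sum]
    refine Finset.sum_congr rfl fun G _ => ?_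
    rw [prod_rhoOf]
    ring
  simp_rw [h3]
  rw [integral_complex_ofReal, integral_finsetSum]
  intro h _
  exact integrable_haar hd (hq.mul ((continuous_amp _).norm.pow 2))

theorem isHermitian_purified {X : OpPow d M}
    (hX : ∀ F G, X F G = ∑ j, ∑ H : Fin M → Fin d, u j (zip F H) * star (u j (zip G H))) :
    X.IsHermitian := by
  ext F G
  rw [Matrix.conjTranspose_apply, hX, hX, star_sum]
  refine Finset.sum_congr rfl fun j _ => ?_
  rw [star_sum]
  refine Finset.sum_congr rfl fun H _ => ?_
  rw [star_mul', star_star, mul_comm]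

theorem isHermitian_measured {Y : OpPow d M} {q : UnitVec d → ℝ}
    (hY : ∀ F G, Y F G = ∫ Ψ, (q Ψ : ℂ) * tensorPow M (rhoOf Ψ) F G ∂(haar d)) :
    Y.IsHermitian := by
  ext F G
  rw [Matrix.conjTranspose_apply, hY, hY, Complex.star_def, ← integral_conj]
  congr 1
  funext Ψ
  rw [map_mul, Complex.conj_ofReal, tensorPow_apply, tensorPow_apply, map_prod]
  congr 1
  exact Finset.prod_congr rfl fun i _ => (isHermitian_rhoOf Ψ).apply _ _

theorem posSemidef_of_quadForm {κ : Type} [Fintype κ] {A : Op κ} (hA : A.IsHermitian)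
    (h : ∀ x : κ → ℂ, ∃ r : ℝ, 0 ≤ r ∧ star x ⬝ᵥ A.mulVec x = r) : A.PosSemidef := by
  refine Matrix.PosSemidef.of_dotProduct_mulVec_nonneg hA fun x => ?_
  obtain ⟨r, hr, hx⟩ := h x
  rw [hx]
  exact_mod_cast hr

theorem posSemidef_reduced_purified (S : Finset (Fin M)) {X : OpPow d M}
    (hX : ∀ F G, X F G = ∑ j, ∑ H : Fin M → Fin d, u j (zip F H) * star (u j (zip G H))) :
    (reduced S X).PosSemidef :=
  posSemidef_of_quadForm (isHermitian_reduced S (isHermitian_purified u hX)) fun x =>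
    ⟨_, by positivity, quadForm_reduced_purified u S hX x⟩

/-- Both quadratic forms are sums over h and j, and `contract_le_integral` with y = x ⊗ e_h compares
them term by term; its constant 2√(D_{M-k}/D_M) - 1 is 1 - 2S. -/
theorem posSemidef_reduced_sub (hd : 1 ≤ d) (S : Finset (Fin M)) (hu : ∀ j, IsSymm (u j))
    {X Y : OpPow d M}
    (hX : ∀ F G, X F G = ∑ j, ∑ H : Fin M → Fin d, u j (zip F H) * star (u j (zip G H)))
    (hY : ∀ F G, Y F G = ∫ Ψ, ((symNum d M * ∑ j, ‖amp (Ψ : K d) (u j)‖ ^ 2 : ℝ) : ℂ) *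
      tensorPow M (rhoOf Ψ) F G ∂(haar d)) :
    (reduced S Y - ((1 - 2 * bigS d M S.card : ℝ) : ℂ) • reduced S X).PosSemidef := by
  have hq : Continuous fun Ψ : UnitVec d => (symNum d M * ∑ j, ‖amp (Ψ : K d) (u j)‖ ^ 2 : ℝ) :=
    continuous_const.mul (continuous_finsetSum _ fun j _ => (continuous_amp (u j)).norm.pow 2)
  refine posSemidef_of_quadForm ((isHermitian_reduced S (isHermitian_measured hY)).sub ?_)
    fun x => ?_
  · rw [Matrix.IsHermitian, Matrix.conjTranspose_smul, Complex.star_def, Complex.conj_ofReal,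
      isHermitian_reduced S (isHermitian_purified u hX)]
  · refine ⟨_, ?_, by
      rw [Matrix.sub_mulVec, Matrix.smul_mulVec, dotProduct_sub, dotProduct_smul,
        quadForm_reduced_purified u S hX, quadForm_reduced_measured hd S hq hY, smul_eq_mul,
        ← Complex.ofReal_mul, ← Complex.ofReal_sub]⟩
    rw [sub_nonneg, Finset.mul_sum]
    refine Finset.sum_le_sum fun h _ => ?_
    have h1 : ∫ Ψ, (symNum d M * ∑ j, ‖amp (Ψ : K d) (u j)‖ ^ 2 : ℝ) *
        ‖amp (Ψ : K d) (lift x h)‖ ^ 2 ∂(haar d) = ∑ j, (symNum d M : ℝ) *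
          ∫ Ψ, ‖amp (Ψ : K d) (u j)‖ ^ 2 * ‖amp (Ψ : K d) (lift x h)‖ ^ 2 ∂(haar d) := by
      rw [← Finset.mul_sum, ← integral_finsetSum, ← integral_const_mul]
      · congr 1
        funext Ψ
        rw [mul_assoc, Finset.sum_mul]
      · exact fun j _ => integrable_haar hd
          (((continuous_amp (u j)).norm.pow 2).mul ((continuous_amp _).norm.pow 2))
    rw [h1, Finset.mul_sum]
    refine Finset.sum_le_sum fun j _ => ?_
    have h2 := contract_le_integral hd (fun i => i ∈ S) (hu j) (lift x h)
    have hcard : Fintype.card {i // ¬i ∈ S} = M - S.card := by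
      rw [Fintype.card_subtype_compl, Fintype.card_fin, Fintype.card_coe]
    rw [Fintype.card_fin, hcard] at h2
    refine le_trans (le_of_eq ?_) h2
    rw [bigS, symDim_eq _ _ hd, symDim_eq _ _ hd]
    ring

theorem traceNorm_reduced_sub_le (hd : 1 ≤ d) (S : Finset (Fin M)) (hu : ∀ j, IsSymm (u j))
    {X Y : OpPow d M} (hXt : X.trace = 1) (hYt : Y.trace = 1)
    (hX : ∀ F G, X F G = ∑ j, ∑ H : Fin M → Fin d, u j (zip F H) * star (u j (zip G H)))
    (hY : ∀ F G, Y F G = ∫ Ψ, ((symNum d M * ∑ j, ‖amp (Ψ : K d) (u j)‖ ^ 2 : ℝ) : ℂ) *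
      tensorPow M (rhoOf Ψ) F G ∂(haar d)) :
    traceNorm (reduced S X - reduced S Y) ≤ 4 * bigS d M S.card := by
  have hk : S.card ≤ M := by simpa using S.card_le_univ
  have hs := bigS_nonneg hd hk
  have h1 := posSemidef_reduced_sub u hd S hu hX hY
  have h2 : (((2 * bigS d M S.card : ℝ) : ℂ) • reduced S X).PosSemidef :=
    (posSemidef_reduced_purified u S hX).smul (by
      exact_mod_cast (by positivity : (0 : ℝ) ≤ 2 * bigS d M S.card))
  have h3 := traceNorm_sub_le h2 h1
  -- X - Y = 2S·X - (Y - (1 - 2S)·X), where both positive terms have trace 2S.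
  have h4 : ((2 * bigS d M S.card : ℝ) : ℂ) • reduced S X -
      (reduced S Y - ((1 - 2 * bigS d M S.card : ℝ) : ℂ) • reduced S X) =
      reduced S X - reduced S Y := by
    push_cast
    module
  rw [h4, Matrix.trace_sub, Matrix.trace_smul, Matrix.trace_smul, trace_reduced, trace_reduced,
    hXt, hYt, smul_eq_mul, smul_eq_mul, mul_one, mul_one, Complex.sub_re, Complex.ofReal_re,
    Complex.ofReal_re, Complex.one_re] at h3
  linarith

end Family

/-! ### The measurement on the input space. -/

section Measurement

variable {d m M : ℕ} (v : Fin m → Fin m → (Fin M → Fin d × Fin d) → ℂ)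

/-- The coherent-state measurement pulled back to the input through the vectors `v c a`. -/
def coherentMeasurement (Ψ : UnitVec d) : Op (Fin m) :=
  Matrix.of fun b a => (symNum d M : ℂ) *
    ∑ c, amp (Ψ : K d) (v c a) * star (amp (Ψ : K d) (v c b))

/-- Exhibits the density as a function of |Ψ⟩⟨Ψ| alone, although a single amplitude depends on the
phase of Ψ. -/
theorem amp_mul_star_amp_eq (Ψ : UnitVec d) (u w : (Fin M → Fin d × Fin d) → ℂ) :
    amp (Ψ : K d) u * star (amp (Ψ : K d) w) =
      ∑ f, ∑ g, u f * star (w g) * ∏ i, proj Ψ (g i) (f i) := by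
  rw [amp, amp, star_sum, Finset.sum_mul_sum]
  refine Finset.sum_congr rfl fun f _ => Finset.sum_congr rfl fun g _ => ?_
  simp only [proj, Matrix.of_apply, Finset.prod_mul_distrib, star_mul', star_star, pw, star_prod]
  ring

theorem isMeasurement_coherent (hd : 1 ≤ d) (hv : ∀ c a, IsSymm (v c a))
    (hone : ∀ a b, ∑ c, ∑ f, v c a f * star (v c b f) = (Matrix.single a b (1 : ℂ)).trace) :
    IsMeasurement (coherentMeasurement v) where
  posSemidef Ψ := by
    let A : Op (Fin m) := Matrix.of fun c a => amp (Ψ : K d) (v c a)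
    have h : coherentMeasurement v Ψ = (symNum d M : ℂ) • (A.conjTranspose * A) := by
      ext b a
      rw [Matrix.smul_apply, Matrix.mul_apply, smul_eq_mul]
      simp only [coherentMeasurement, Matrix.of_apply, Matrix.conjTranspose_apply, A, mul_comm]
    rw [h]
    exact (Matrix.posSemidef_conjTranspose_mul_self A).smul (Nat.cast_nonneg _)
  congr_proj Ψ Ψ' h := by
    ext b a
    simp only [coherentMeasurement, Matrix.of_apply, amp_mul_star_amp_eq, h]
  integrable b a := integrable_haar hd (continuous_const.mul (continuous_finsetSum _ fun c _ =>
    (continuous_amp (v c a)).mul (continuous_amp (v c b)).star))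
  integral_eq_one b a := by
    simp only [coherentMeasurement, Matrix.of_apply]
    rw [integral_const_mul, integral_sum_haar hd
      (F := fun c Ψ => amp (Ψ : K d) (v c a) * star (amp (Ψ : K d) (v c b)))
      fun c => (continuous_amp (v c a)).mul (continuous_amp (v c b)).star, Finset.mul_sum]
    have h (c : Fin m) := integral_amp_mul_star_amp hd (hv c a) (v := v c b)
    simp only [Fintype.card_fin] at h
    simp_rw [h, hone]
    by_cases hab : a = b
    · subst hab
      rw [Matrix.trace_single_eq_same, Matrix.one_apply_eq]
    · rw [Matrix.trace_single_eq_of_ne a b 1 hab, Matrix.one_apply_ne' hab]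

/-- The vectors of the ensemble obtained from the purified channel applied to `Bᴴ B`. -/
def ensemble (B : Op (Fin m)) (j : Fin m × Fin m) (f : Fin M → Fin d × Fin d) : ℂ :=
  ∑ a, star (B j.2 a) * v j.1 a f

theorem isSymm_ensemble (hv : ∀ c a, IsSymm (v c a)) (B : Op (Fin m)) (j) :
    IsSymm (ensemble v B j) := fun π f =>
  Finset.sum_congr rfl fun a _ => congrArg _ (hv j.1 a π f)

theorem amp_ensemble (B : Op (Fin m)) (j) (x : Fin d × Fin d → ℂ) :
    amp x (ensemble v B j) = ∑ a, star (B j.2 a) * amp x (v j.1 a) := by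
  simp only [amp, ensemble, Finset.mul_sum]
  rw [Finset.sum_comm]
  exact Finset.sum_congr rfl fun a _ => Finset.sum_congr rfl fun f _ => by ring

/-- Writing the input as B†B turns a sesquilinear sum over input indices into a sum over ensemble
vectors. It serves both the channel output and the outcome density, so both are expressed through
the same vectors. -/
theorem sum_gram_ensemble {α β : Type} [Fintype α] [Fintype β] (B : Op α) (s t : β → α → ℂ) :
    ∑ a, ∑ b, (B.conjTranspose * B) a b * ∑ c, s c a * star (t c b) =
      ∑ j : β × α, (∑ a, star (B j.2 a) * s j.1 a) * star (∑ b, star (B j.2 b) * t j.1 b) := by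
  have h (a b : α) : (B.conjTranspose * B) a b * ∑ c, s c a * star (t c b) =
      ∑ j : β × α, star (B j.2 a) * s j.1 a * star (star (B j.2 b) * t j.1 b) := by
    rw [Matrix.mul_apply, Finset.sum_mul_sum, Finset.sum_comm, Fintype.sum_prod_type]
    refine Finset.sum_congr rfl fun c _ => Finset.sum_congr rfl fun l _ => ?_
    rw [Matrix.conjTranspose_apply, star_mul', star_star]
    ring
  simp_rw [h, star_sum, Finset.sum_mul_sum]
  exact (Finset.sum_congr rfl fun a _ => Finset.sum_comm).trans Finset.sum_comm

theorem channel_apply_eq (E : Op (Fin m) →CP OpPow d M) (X : Op (Fin m)) (F G) :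
    E X F G = ∑ a, ∑ b, X a b * E (Matrix.single a b 1) F G := by
  conv_lhs => rw [Matrix.matrix_eq_sum_single X]
  have h (a b : Fin m) : E (Matrix.single a b (X a b)) = X a b • E (Matrix.single a b 1) := by
    rw [← map_smul, Matrix.smul_single, smul_eq_mul, mul_one]
  simp only [map_sum, h, Matrix.sum_apply, Matrix.smul_apply, smul_eq_mul]

theorem channel_gram_eq {E : Op (Fin m) →CP OpPow d M}
    (hE : ∀ a b F G, E (Matrix.single a b 1) F G =
      ∑ c, ∑ H : Fin M → Fin d, v c a (zip F H) * star (v c b (zip G H)))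
    (B : Op (Fin m)) (F G) : E (B.conjTranspose * B) F G = ∑ j, ∑ H : Fin M → Fin d,
      ensemble v B j (zip F H) * star (ensemble v B j (zip G H)) := by
  have h (H : Fin M → Fin d) := sum_gram_ensemble B (fun c a => v c a (zip F H))
    fun c a => v c a (zip G H)
  rw [channel_apply_eq]
  refine Eq.symm (Finset.sum_comm.trans ((Finset.sum_congr rfl fun H _ => (h H).symm).trans
    (Finset.sum_comm.trans (Finset.sum_congr rfl fun a _ => Finset.sum_comm.trans
    (Finset.sum_congr rfl fun b _ => ?_)))))
  rw [← Finset.mul_sum, Finset.sum_comm, hE]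

theorem trace_coherentMeasurement_mul (B : Op (Fin m)) (Ψ : UnitVec d) :
    (coherentMeasurement v Ψ * (B.conjTranspose * B)).trace =
      ((symNum d M * ∑ j, ‖amp (Ψ : K d) (ensemble v B j)‖ ^ 2 : ℝ) : ℂ) := by
  push_cast
  simp_rw [← Complex.mul_conj', ← Complex.star_def, amp_ensemble]
  rw [← sum_gram_ensemble B (fun c a => amp (Ψ : K d) (v c a)) fun c a => amp (Ψ : K d) (v c a),
    Matrix.trace_mul_comm, Matrix.trace, Finset.mul_sum]
  refine Finset.sum_congr rfl fun a _ => ?_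
  rw [Matrix.diag_apply, Matrix.mul_apply, Finset.mul_sum]
  refine Finset.sum_congr rfl fun b _ => ?_
  rw [coherentMeasurement, Matrix.of_apply]
  ring

theorem trace_measurePrepare {P : UnitVec d → Op (Fin m)} (hP : IsMeasurement P)
    (ρ : Op (Fin m)) : (measurePrepare M P ρ).trace = ρ.trace := by
  have hint (F G : Fin M → Fin d) :
      Integrable (fun Ψ => (P Ψ * ρ).trace * tensorPow M (rhoOf Ψ) F G) (haar d) := by
    have h1 : Integrable (fun Ψ => (P Ψ * ρ).trace) (haar d) := by
      simp only [Matrix.trace, Matrix.diag_apply, Matrix.mul_apply]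
      exact integrable_finsetSum _ fun a _ => integrable_finsetSum _ fun b _ =>
        (hP.integrable a b).mul_const _
    have hc : Continuous fun Ψ : UnitVec d => tensorPow M (rhoOf Ψ) F G :=
      continuous_prod_rhoOf F G
    obtain ⟨C, hC⟩ := isCompact_univ.exists_bound_of_continuousOn hc.continuousOn
    exact h1.mul_bdd hc.aestronglyMeasurable (Filter.Eventually.of_forall fun Ψ => hC Ψ trivial)
  have h0 : (measurePrepare M P ρ).trace =
      ∑ F, ∫ Ψ, (P Ψ * ρ).trace * tensorPow M (rhoOf Ψ) F F ∂(haar d) := rfl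
  rw [h0, ← integral_finsetSum _ fun F _ => hint F F]
  have h2 (Ψ : UnitVec d) : ∑ F, (P Ψ * ρ).trace * tensorPow M (rhoOf Ψ) F F =
      ∑ a, ∑ b, P Ψ a b * ρ b a := by
    rw [← Finset.mul_sum]
    simp only [tensorPow_apply]
    rw [sum_prod_rhoOf, mul_one]
    simp only [Matrix.trace, Matrix.diag_apply, Matrix.mul_apply]
  refine (integral_congr_ae (Filter.Eventually.of_forall h2)).trans ?_
  rw [integral_finsetSum _ fun a _ => integrable_finsetSum _ fun b _ =>
    (hP.integrable a b).mul_const _]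
  refine Finset.sum_congr rfl fun a _ => ?_
  rw [integral_finsetSum _ fun b _ => (hP.integrable a b).mul_const _]
  simp_rw [integral_mul_const, hP.integral_eq_one]
  simp [Matrix.one_apply]

end Measurement

/-! ### Assembly of the measurement and the bounds. -/

theorem exists_measurement {d m M : ℕ} (hd : 1 ≤ d) {E : Op (Fin m) →CP OpPow d M}
    (hE : IsSDIChannel E) :
    ∃ P : UnitVec d → Op (Fin m), IsMeasurement P ∧
      ∀ (S : Finset (Fin M)) (ρ : Op (Fin m)), IsState ρ →
        traceNorm (reduced S (E ρ) - reduced S (measurePrepare M P ρ)) ≤ 4 * bigS d M S.card := by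
  obtain ⟨v, hv, hEv⟩ := hE.exists_purification
  -- Trace preservation on matrix units is what normalizes the measurement.
  have hone (a b) : ∑ c, ∑ f, v c a f * star (v c b f) = (Matrix.single a b (1 : ℂ)).trace := by
    rw [← hE.trace_preserving, Matrix.trace]
    simp only [Matrix.diag_apply, hEv]
    conv_rhs => rw [Finset.sum_comm]
    exact Finset.sum_congr rfl fun c _ => sum_zip fun f => v c a f * star (v c b f)
  have hP := isMeasurement_coherent v hd hv hone
  refine ⟨coherentMeasurement v, hP, fun S ρ hρ => ?_⟩
  obtain ⟨B, hB⟩ := CStarAlgebra.nonneg_iff_eq_star_mul_self.1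
    (Matrix.nonneg_iff_posSemidef.2 hρ.posSemidef)
  rw [Matrix.star_eq_conjTranspose] at hB
  refine traceNorm_reduced_sub_le (ensemble v B) hd S (isSymm_ensemble v hv B) ?_ ?_ ?_ ?_
  · rw [hE.trace_preserving, hρ.trace_eq_one]
  · rw [trace_measurePrepare hP, hρ.trace_eq_one]
  · rw [hB]
    exact channel_gram_eq v hEv B
  · intro F G
    simp only [measurePrepare, Matrix.of_apply]
    rw [hB]
    simp_rw [trace_coherentMeasurement_mul]

end SDI

end

theorem theorem2 :
    (∀ (d m M : ℕ), 1 ≤ d →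
      ∀ E : SDI.Op (Fin m) →CP SDI.OpPow d M, SDI.IsSDIChannel E →
        ∃ P : SDI.UnitVec d → SDI.Op (Fin m), SDI.IsMeasurement P ∧
          ∀ (k : ℕ) (S : Finset (Fin M)), S.card = k →
            ∀ ρ : SDI.Op (Fin m), SDI.IsState ρ →
              SDI.traceNorm
                  (SDI.reduced S (E ρ) - SDI.reduced S (SDI.measurePrepare M P ρ))
                ≤ 4 * SDI.bigS d M k ∧
              SDI.traceNorm
                  (SDI.reduced S (E ρ) - SDI.reduced S (SDI.measurePrepare M P ρ))
                ≤ 2 * ((d : ℝ) ^ 2 - 1) * k / M) ∧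
    (∀ ε : ℝ, 0 < ε → ∃ C : ℝ, ∀ d M k : ℕ, 1 ≤ d → k ≤ M → C * (k * (d : ℝ) ^ 2) ≤ M →
      |4 * SDI.bigS d M k - 2 * ((d : ℝ) ^ 2 - 1) * k / M|
        ≤ ε * (2 * ((d : ℝ) ^ 2 - 1) * k / M)) := by
  refine ⟨fun d m M hd E hE => ?_, SDI.bigS_asymptotic⟩
  obtain ⟨P, hP, h⟩ := SDI.exists_measurement hd hE
  refine ⟨P, hP, ?_⟩
  rintro k S rfl ρ hρ
  have hk : S.card ≤ M := by simpa using S.card_le_univ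
  exact ⟨h S ρ hρ, (h S ρ hρ).trans (SDI.four_mul_bigS_le hd hk)⟩
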